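/- A pomonoid is a monoid $M$ with a partial order for which multiplication is isotone in both arguments; a pogroup is a pomonoid that is a group. For a poset $P$ let $\mathrm{Id}\,P$ be the poset, ordered by inclusion, of non-empty finitely generated downsets ${\downarrow}\{x_1,\dots,x_m\}$ of $P$. A pomonoid $M$ is *integral* if $x\le 1$ for all $x$; *integrally closed* if $ax\le a$ implies $x\le 1$ and $xa\le a$ implies $x\le 1$; *residuated* if there are binary operations $\backslash,/$ on $M$ with $b\le a\backslash c\iff ab\le c\iff a\le c/b$; and *ideally residuated* if there are operations $M\times M\to \mathrm{Id}\,M$ with ${\downarrow}b\subseteq a\backslash c\iff ab\le c\iff {\downarrow}a\subseteq c/b$. A *nucleus* on $M$ is a closure operator $\gamma$ with $\gamma(a)\gamma(b)\le\gamma(ab)$; the *nuclear image* $M_\gamma$ is the set of $a$ with $\gamma(a)=a$, with the inherited order, product $\gamma(ab)$ and unit $\gamma(1)$. An *ideal conucleus* on $M$ is a monotone map $\sigma\colon M\to\mathrm{Id}\,M$ such that $\bigcup_{x\in\sigma(a)}\sigma(x)=\sigma(a)\subseteq{\downarrow}a$, ${\downarrow}(\sigma(a)\cdot\sigma(b))\subseteq\sigma(ab)$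 and $\sigma(1)={\downarrow}1$; the *ideal conuclear image* $M_\sigma$ is the subpomonoid of those $a$ with ${\downarrow}a=\sigma(a)$. The ideal conucleus $\sigma$ is *negative* if $\sigma(a)\subseteq{\downarrow}1$ for all $a$. Images are considered up to isomorphism of pomonoids. For a pomonoid $M$, the free unital nuclear preimage $F^+(M)$ is the pomonoid obtained from the set of non-empty words over $M$, with concatenation as product and unit $[1]$, by taking the quotient to a partial order of the preorder in which $u\sqsubseteq[a_1,\dots,a_n]$ iff $u=u_1\circ\dots\circ u_n$ for some possibly empty words $u_i$ whose product in $M$ is $\le a_i$ (the empty product being $1$). Let $G(M)$ be the set of words in letters $[a]$ and formal inverses $[a]^{-1}$ ($a\in M$), with concatenation as product, modulo the equivalence of the following preorder and ordered by it. For a positive word $u=[a_1,\dots,a_n]$ put $u^{-1}=[a_n]^{-1}\cdots[a_1]^{-1}$; below, $u,v,w,x,y$ are possibly empty positive words, and conditions on them are read in $F^+(M)$, where the empty word denotes the unit. The preorder is the reflexive transitive closure of all instances, in arbitrary contexts $\alpha\,\_\,\beta$, of - $u\sqsubseteq[a]$ and $[a]^{-1}\sqsubseteq u^{-1}$ if $u\sqsubseteq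 [a]$; - $u^{-1}vw^{-1}\sqsubseteq x$ if $v\sqsubseteq u\circ x\circ w$, and $x\sqsubseteq u^{-1}vw^{-1}$ if $u\circ x\circ w\sqsubseteq v$ ($u,w$ not both empty); - $uv^{-1}\sqsubseteq x^{-1}y$ if $x\circ u\sqsubseteq y\circ v$ ($v,x$ non-empty), and $u^{-1}v\sqsubseteq xy^{-1}$ if $v\circ y\sqsubseteq u\circ x$ ($u,y$ non-empty). **Theorem.** Let $M$ be a pomonoid. 1. $G(M)$, with the canonical homomorphism $\iota\colon F^+(M)\to G(M)$ sending the class of a word to the class of that word, is the free pogroup over the pomonoid $F^+(M)$: every order-preserving monoid homomorphism from $F^+(M)$ to a pogroup factors through $\iota$ by a unique order-preserving homomorphism. 2. If $M$ is ideally residuated and integrally closed, then $F^+(M)$ is an ideal conuclear image of $G(M)$: there is an ideal conucleus $\sigma$ on $G(M)$ such that $\iota$ is an isomorphism of pomonoids from $F^+(M)$ onto $G(M)_\sigma$. 3. $M$ is integrally closed and ideally residuated if and only if $M$ is a nuclear image of an ideal conuclear image of a pogroup. 4. $M$ is integral and ideally residuated if and only if $M$ is a nuclear image of an ideal conuclear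 image of a pogroup with respect to a negative ideal conucleus. 5. $M$ is integral and residuated if and only if $M$ is a nuclear image of an ideal conuclear image of a pogroup with respect to a negative ideal conucleus $\sigma$ such that $\sigma(u^{-1}v)$ and $\sigma(uv^{-1})$ are principal downsets whenever $u$ and $v$ lie in the ideal conuclear image. -/

import Mathlib

universe u v

namespace Pom

/-! A pomonoid is a `Monoid` with a `PartialOrder` whose multiplication is isotone in both
arguments (`MulLeftMono`, `MulRightMono`); a pogroup is a `Group` with the same structure. -/

section Downsets

variable (P : Type u) [PartialOrder P]

/-- The poset of non-empty finitely generated downsets of `P`, ordered by inclusion. -/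
def FGDownset : Type u :=
  {X : LowerSet P // ∃ F : Set P, F.Finite ∧ F.Nonempty ∧ X = lowerClosure F}

instance : PartialOrder (FGDownset P) :=
  inferInstanceAs (PartialOrder {X : LowerSet P //
    ∃ F : Set P, F.Finite ∧ F.Nonempty ∧ X = lowerClosure F})

instance : Membership P (FGDownset P) := ⟨fun X a => a ∈ X.1⟩

variable {P}

/-- The principal downset `↓a`. -/
def principal (a : P) : FGDownset P :=
  ⟨lowerClosure {a}, {a}, Set.finite_singleton a, Set.singleton_nonempty a, rfl⟩

/-- A downset is principal if it is of the form `↓a`. -/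
def IsPrincipal (X : FGDownset P) : Prop := ∃ a : P, X = principal a

/-- The extension of a monotone map `f : P → FGDownset P` to downsets:
`↓{x₁, …, xₘ} ↦ f x₁ ∪ ⋯ ∪ f xₘ`. Since `f` is monotone, the union over the generators is the
union over all elements of the downset. -/
def sharp (f : P →o FGDownset P) (X : FGDownset P) : FGDownset P :=
  ⟨⨆ x ∈ X.1, (f x).1, by
    obtain ⟨X, F, hF, ⟨a, ha⟩, rfl⟩ := X
    choose G hG hne hGe using fun x => (f x).2
    refine ⟨⋃ x ∈ F, G x, hF.biUnion fun x _ => hG x, ?_, ?_⟩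
    · obtain ⟨b, hb⟩ := hne a
      exact ⟨b, Set.mem_biUnion ha hb⟩
    · have e : lowerClosure (⋃ x ∈ F, G x) = ⨆ x ∈ F, lowerClosure (G x) := by
        simp only [lowerClosure_iUnion]
      rw [e]
      apply le_antisymm
      · refine iSup₂_le fun x hx => ?_
        obtain ⟨y, hy, hxy⟩ := mem_lowerClosure.1 hx
        calc (f x).1 ≤ (f y).1 := f.monotone hxy
          _ = lowerClosure (G y) := hGe y
          _ ≤ _ := le_iSup₂_of_le y hy le_rfl
      · refine iSup₂_le fun y hy => ?_
        rw [← hGe y]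
        exact le_iSup₂_of_le (f := fun x (_ : x ∈ lowerClosure F) => (f x).1) y
          (subset_lowerClosure hy) le_rfl⟩

variable {M : Type u} [Monoid M] [PartialOrder M] [MulLeftMono M] [MulRightMono M]

/-- The product `X ∗ Y = ↓(X · Y)` of finitely generated downsets of a pomonoid. -/
instance : Mul (FGDownset M) where
  mul X Y := ⟨lowerClosure {z | ∃ x ∈ X, ∃ y ∈ Y, x * y = z}, by
    obtain ⟨X, F, hF, hFne, rfl⟩ := X
    obtain ⟨Y, G, hG, hGne, rfl⟩ := Y
    refine ⟨Set.image2 (· * ·) F G, hF.image2 _ hG, hFne.image2 hGne, ?_⟩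
    apply le_antisymm
    · rw [lowerClosure_le]
      rintro _ ⟨x, hx, y, hy, rfl⟩
      obtain ⟨p, hp, hxp⟩ := mem_lowerClosure.1 hx
      obtain ⟨q, hq, hyq⟩ := mem_lowerClosure.1 hy
      exact mem_lowerClosure.2 ⟨p * q, ⟨p, hp, q, hq, rfl⟩, mul_le_mul' hxp hyq⟩
    · apply lowerClosure_mono
      rintro _ ⟨x, hx, y, hy, rfl⟩
      exact ⟨x, subset_lowerClosure hx, y, subset_lowerClosure hy, rfl⟩⟩

end Downsets

section Properties

variable (M : Type u) [Monoid M] [PartialOrder M]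

/-- The unit is the top element. -/
def Integral : Prop := ∀ x : M, x ≤ 1

def IntegrallyClosed : Prop :=
  ∀ a x : M, (a * x ≤ a → x ≤ 1) ∧ (x * a ≤ a → x ≤ 1)

/-- Both residuals of the multiplication exist. -/
def Residuated : Prop :=
  ∃ (ld rd : M → M → M), ∀ a b c : M,
    (b ≤ ld a c ↔ a * b ≤ c) ∧ (a * b ≤ c ↔ a ≤ rd c b)

/-- Both ideal residuals of the multiplication exist. -/
def IdeallyResiduated : Prop :=
  ∃ (ld rd : M → M → FGDownset M), ∀ a b c : M,
    (principal b ≤ ld a c ↔ a * b ≤ c) ∧ (a * b ≤ c ↔ principal a ≤ rd c b)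

end Properties

section Nuclei

/-- A nucleus on a pomonoid: a closure operator `γ` with `γ a * γ b ≤ γ (a * b)`. -/
structure PoNucleus (M : Type u) [Monoid M] [PartialOrder M] extends ClosureOperator M where
  mul_le : ∀ a b : M, toFun a * toFun b ≤ toFun (a * b)

variable {M : Type u} [Monoid M] [PartialOrder M]

/-- The set of `γ`-closed elements. -/
def PoNucleus.Image (γ : PoNucleus M) : Type u := {a : M // γ.toFun a = a}

instance (γ : PoNucleus M) : PartialOrder γ.Image :=
  inferInstanceAs (PartialOrder {a : M // γ.toFun a = a})

theorem PoNucleus.idem (γ : PoNucleus M) (a : M) : γ.toFun (γ.toFun a) = γ.toFun a :=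
  γ.idempotent' a

theorem PoNucleus.le (γ : PoNucleus M) (a : M) : a ≤ γ.toFun a := γ.le_closure' a

theorem PoNucleus.mono (γ : PoNucleus M) {a b : M} (h : a ≤ b) : γ.toFun a ≤ γ.toFun b :=
  γ.monotone' h

variable [MulLeftMono M] [MulRightMono M]

theorem PoNucleus.map_mul_left (γ : PoNucleus M) (a b : M) :
    γ.toFun (γ.toFun a * b) = γ.toFun (a * b) := by
  apply le_antisymm
  · calc γ.toFun (γ.toFun a * b) ≤ γ.toFun (γ.toFun a * γ.toFun b) :=
          γ.mono (mul_le_mul_right (γ.le b) _)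
      _ ≤ γ.toFun (γ.toFun (a * b)) := γ.mono (γ.mul_le a b)
      _ = γ.toFun (a * b) := γ.idem _
  · exact γ.mono (mul_le_mul_left (γ.le a) b)

theorem PoNucleus.map_mul_right (γ : PoNucleus M) (a b : M) :
    γ.toFun (a * γ.toFun b) = γ.toFun (a * b) := by
  apply le_antisymm
  · calc γ.toFun (a * γ.toFun b) ≤ γ.toFun (γ.toFun a * γ.toFun b) :=
          γ.mono (mul_le_mul_left (γ.le a) _)
      _ ≤ γ.toFun (γ.toFun (a * b)) := γ.mono (γ.mul_le a b)
      _ = γ.toFun (a * b) := γ.idem _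
  · exact γ.mono (mul_le_mul_right (γ.le b) a)

/-- The nuclear image: closed elements with the product `γ (a * b)` and the unit `γ 1`. -/
instance (γ : PoNucleus M) : Monoid γ.Image where
  mul a b := ⟨γ.toFun (a.1 * b.1), γ.idem _⟩
  one := ⟨γ.toFun 1, γ.idem _⟩
  mul_assoc a b c := Subtype.ext <| by
    change γ.toFun (γ.toFun (a.1 * b.1) * c.1) = γ.toFun (a.1 * γ.toFun (b.1 * c.1))
    rw [γ.map_mul_left, γ.map_mul_right, mul_assoc]
  one_mul a := Subtype.ext <| by
    change γ.toFun (γ.toFun 1 * a.1) = a.1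
    rw [γ.map_mul_left, one_mul, a.2]
  mul_one a := Subtype.ext <| by
    change γ.toFun (a.1 * γ.toFun 1) = a.1
    rw [γ.map_mul_right, mul_one, a.2]

instance (γ : PoNucleus M) : MulLeftMono γ.Image where
  elim a b c h := γ.mono (mul_le_mul_right (show b.1 ≤ c.1 from h) a.1)

instance (γ : PoNucleus M) : MulRightMono γ.Image where
  elim a b c h := γ.mono (mul_le_mul_left (show b.1 ≤ c.1 from h) a.1)

end Nuclei

section Conuclei

/-- An ideal conucleus on a pomonoid `M`: a monotone map `σ` from `M` to the finitely generated
non-empty downsets of `M` with `σ♯ (σ a) = σ a ⊆ ↓a`, `σ a ∗ σ b ⊆ σ (a * b)` and `σ 1 = ↓1`. -/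
structure IdealConucleus (M : Type u) [Monoid M] [PartialOrder M] [MulLeftMono M] [MulRightMono M]
    extends M →o FGDownset M where
  sharp_apply : ∀ a : M, sharp toOrderHom (toFun a) = toFun a
  apply_le : ∀ a : M, toFun a ≤ principal a
  mul_le : ∀ a b : M, toFun a * toFun b ≤ toFun (a * b)
  apply_one : toFun 1 = principal 1

variable {M : Type u} [Monoid M] [PartialOrder M] [MulLeftMono M] [MulRightMono M]

/-- The image of an ideal conucleus: the submonoid of the `σ`-open elements, with the order and
the multiplication inherited from `M`. -/
def IdealConucleus.image (σ : IdealConucleus M) : Submonoid M where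
  carrier := {a | principal a = σ.toFun a}
  one_mem' := σ.apply_one.symm
  mul_mem' {a b} ha hb := by
    refine le_antisymm ?_ (σ.apply_le _)
    refine le_trans ?_ (σ.mul_le a b)
    rw [← show principal a = σ.toFun a from ha, ← show principal b = σ.toFun b from hb]
    refine lowerClosure_mono ?_
    rintro _ rfl
    exact ⟨a, subset_lowerClosure rfl, b, subset_lowerClosure rfl, rfl⟩

instance (S : Submonoid M) : MulLeftMono S where
  elim a b c h := mul_le_mul_right (show (b : M) ≤ c from h) (a : M)

instance (S : Submonoid M) : MulRightMono S where
  elim a b c h := mul_le_mul_left (show (b : M) ≤ c from h) (a : M)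

def IdealConucleus.Negative (σ : IdealConucleus M) : Prop :=
  ∀ a : M, σ.toFun a ≤ principal 1

/-- For open `x`, `y`, the downsets `σ (x⁻¹ * y)` and `σ (x * y⁻¹)` are principal. -/
def IdealConucleus.PrincipalOnQuotients {G : Type u} [Group G] [PartialOrder G] [MulLeftMono G]
    [MulRightMono G] (σ : IdealConucleus G) : Prop :=
  ∀ x ∈ σ.image, ∀ y ∈ σ.image,
    IsPrincipal (σ.toFun (x⁻¹ * y)) ∧ IsPrincipal (σ.toFun (x * y⁻¹))

end Conuclei

section FreePreimage

/-- Non-empty words over `M`. -/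
structure NEWord (M : Type u) where
  letters : List M
  ne_nil : letters ≠ []

variable {M : Type u} [Monoid M] [PartialOrder M]

/-- `u ⊑ [a₁, …, aₙ]` iff `u = u₁ ∘ ⋯ ∘ uₙ` for some (possibly empty) words `uᵢ` whose products
in `M` satisfy `γ(uᵢ) ≤ aᵢ`. -/
def WordLE (w v : List M) : Prop :=
  ∃ us : List (List M), us.flatten = w ∧ List.Forall₂ (fun x a => x.prod ≤ a) us v

theorem WordLE.refl (w : List M) : WordLE w w := by
  refine ⟨w.map fun a => [a], ?_, ?_⟩
  · induction w with
    | nil => rfl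
    | cons a t ih => simpa using ih
  · rw [List.forall₂_map_left_iff]
    exact List.forall₂_same.2 fun a _ => by simp

theorem WordLE.append {w v w' v' : List M} (h : WordLE w v) (h' : WordLE w' v') :
    WordLE (w ++ w') (v ++ v') := by
  obtain ⟨us, rfl, hu⟩ := h
  obtain ⟨us', rfl, hu'⟩ := h'
  exact ⟨us ++ us', by simp, by
    induction hu with
    | nil => simpa using hu'
    | cons h _ ih => exact .cons h ih⟩

theorem WordLE.one_append (w : List M) : WordLE w (1 :: w) := by
  have h : WordLE ([] : List M) [1] := ⟨[[]], by simp, by simp⟩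
  exact h.append (WordLE.refl w)

theorem WordLE.append_one (w : List M) : WordLE w (w ++ [1]) := by
  have h : WordLE ([] : List M) [1] := ⟨[[]], by simp, by simp⟩
  simpa using (WordLE.refl w).append h

theorem WordLE.of_append {w v v' : List M} (h : WordLE w (v ++ v')) :
    ∃ x x', w = x ++ x' ∧ WordLE x v ∧ WordLE x' v' := by
  obtain ⟨us, rfl, hu⟩ := h
  refine ⟨(us.take v.length).flatten, (us.drop v.length).flatten, ?_, ⟨_, rfl, ?_⟩, ⟨_, rfl, ?_⟩⟩
  · rw [← List.flatten_append, List.take_append_drop]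
  · simpa using List.forall₂_take v.length hu
  · simpa using List.forall₂_drop v.length hu

variable [MulLeftMono M] [MulRightMono M]

theorem WordLE.prod_le {w v : List M} (h : WordLE w v) : w.prod ≤ v.prod := by
  obtain ⟨us, rfl, hu⟩ := h
  induction hu with
  | nil => simp
  | cons h _ ih => simpa using mul_le_mul' h ih

theorem WordLE.trans {w v z : List M} (h : WordLE w v) (h' : WordLE v z) : WordLE w z := by
  obtain ⟨us, rfl, hu⟩ := h'
  induction hu generalizing w with
  | nil => simpa using h
  | @cons x a us z hx _ ih =>
    rw [List.flatten_cons] at h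
    obtain ⟨p, q, rfl, hp, hq⟩ := h.of_append
    have hpa : WordLE p [a] := ⟨[p], by simp, .cons (hp.prod_le.trans hx) .nil⟩
    exact hpa.append (ih hq)

instance : Preorder (NEWord M) where
  le w v := WordLE w.letters v.letters
  le_refl w := WordLE.refl _
  le_trans _ _ _ := WordLE.trans

variable (M) in
/-- The free unital nuclear preimage of `M`: the partially ordered skeleton of the preordered set
of non-empty words, with concatenation as product and the singleton word `[1]` as unit. -/
def FPlus : Type u := Antisymmetrization (NEWord M) (· ≤ ·)

instance : PartialOrder (FPlus M) :=
  inferInstanceAs (PartialOrder (Antisymmetrization (NEWord M) (· ≤ ·)))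

/-- The class of a non-empty word. -/
def FPlus.mk (w : NEWord M) : FPlus M := toAntisymmetrization (· ≤ ·) w

/-- The class of a singleton word. -/
def FPlus.of (a : M) : FPlus M := FPlus.mk ⟨[a], by simp⟩

theorem FPlus.mk_le {w v : NEWord M} : FPlus.mk w ≤ FPlus.mk v ↔ WordLE w.letters v.letters :=
  Iff.rfl

instance : Monoid (FPlus M) where
  mul := Quotient.map₂ (fun w v => ⟨w.letters ++ v.letters, by simp [w.ne_nil]⟩)
    fun _ _ h _ _ h' => ⟨h.1.append h'.1, h.2.append h'.2⟩
  one := FPlus.of 1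
  mul_assoc := by
    rintro ⟨x⟩ ⟨y⟩ ⟨z⟩
    apply congrArg FPlus.mk
    simp
  one_mul := by
    rintro ⟨⟨w, hw⟩⟩
    refine le_antisymm ?_ (WordLE.one_append w)
    obtain ⟨a, t, rfl⟩ := List.exists_cons_of_ne_nil hw
    have h : WordLE [1, a] [a] := ⟨[[1, a]], by simp, by simp⟩
    exact h.append (WordLE.refl t)
  mul_one := by
    rintro ⟨⟨w, hw⟩⟩
    refine le_antisymm ?_ (WordLE.append_one w)
    obtain ⟨t, a, rfl⟩ : ∃ t a, w = t ++ [a] :=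
      ⟨_, _, (List.dropLast_append_getLast hw).symm⟩
    have h : WordLE [a, 1] [a] := ⟨[[a, 1]], by simp, by simp⟩
    have := (WordLE.refl t).append h
    change WordLE ((t ++ [a]) ++ [1]) (t ++ [a])
    simpa using this

instance : MulLeftMono (FPlus M) where
  elim := by
    rintro ⟨x⟩ ⟨y⟩ ⟨z⟩ h
    exact (WordLE.refl x.letters).append h

instance : MulRightMono (FPlus M) where
  elim := by
    rintro ⟨x⟩ ⟨y⟩ ⟨z⟩ h
    exact WordLE.append h (WordLE.refl x.letters)

/-- The element of `FPlus M` represented by a word; the empty word represents the unit. -/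
def FPlus.val (w : List M) : FPlus M := (w.map FPlus.of).prod

theorem FPlus.val_cons (a : M) (w : List M) : FPlus.val (a :: w) = FPlus.of a * FPlus.val w := by
  simp [FPlus.val]

theorem FPlus.val_append (w v : List M) :
    FPlus.val (w ++ v) = FPlus.val w * FPlus.val v := by
  simp [FPlus.val]

theorem FPlus.val_eq_mk (w : NEWord M) : FPlus.val w.letters = FPlus.mk w := by
  obtain ⟨w, hw⟩ := w
  induction w with
  | nil => exact absurd rfl hw
  | cons a t ih =>
    rcases eq_or_ne t [] with rfl | ht
    · simp [FPlus.val, FPlus.of]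
    · change FPlus.val (a :: t) = _
      rw [FPlus.val_cons, show FPlus.val t = FPlus.mk ⟨t, ht⟩ from ih ht]
      rfl

theorem FPlus.val_le_of {w : List M} {a : M} (h : w.prod ≤ a) : FPlus.val w ≤ FPlus.of a := by
  rcases eq_or_ne w [] with rfl | hw
  · exact (show WordLE [1] [a] from ⟨[[1]], by simp, by simpa using h⟩)
  · rw [show FPlus.val w = FPlus.mk ⟨w, hw⟩ from FPlus.val_eq_mk ⟨w, hw⟩]
    exact (show WordLE w [a] from ⟨[w], by simp, by simpa using h⟩)

end FreePreimage

section FreePogroup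

/-- A word in the positive letters `[a]`, encoded as `(a, true)`, and the formal negative letters
`[a]⁻¹`, encoded as `(a, false)`. -/
structure GWord (M : Type u) where
  letters : List (M × Bool)

/-- `w` as a positive word. -/
def pos {M : Type u} (w : List M) : List (M × Bool) := w.map fun a => (a, true)

/-- The formal inverse `[aₙ]⁻¹ ∘ ⋯ ∘ [a₁]⁻¹` of the positive word `w = [a₁, …, aₙ]`. -/
def neg {M : Type u} (w : List M) : List (M × Bool) := (w.map fun a => (a, false)).reverse

/-- The formal inverse of an arbitrary word. -/
def formalInv {M : Type u} (α : List (M × Bool)) : List (M × Bool) :=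
  (α.map fun p => (p.1, !p.2)).reverse

theorem formalInv_formalInv {M : Type u} (α : List (M × Bool)) : formalInv (formalInv α) = α := by
  simp [formalInv, Function.comp_def]

variable {M : Type u} [Monoid M] [PartialOrder M] [MulLeftMono M] [MulRightMono M]

open FPlus in
/-- The basic inequalities; `u`, `v`, `w`, `x`, `y` are possibly empty words over `M`. -/
inductive Rule : List (M × Bool) → List (M × Bool) → Prop
  | posMono (u : List M) (a : M) (h : val u ≤ of a) : Rule (pos u) (pos [a])
  | negMono (u : List M) (a : M) (h : val u ≤ of a) : Rule (neg [a]) (neg u)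
  | contraction (u v w x : List M) (hne : u ≠ [] ∨ w ≠ [])
      (h : val v ≤ val u * val x * val w) : Rule (neg u ++ pos v ++ neg w) (pos x)
  | expansion (u v w x : List M) (hne : u ≠ [] ∨ w ≠ [])
      (h : val u * val x * val w ≤ val v) : Rule (pos x) (neg u ++ pos v ++ neg w)
  | permutation₁ (u v x y : List M) (hv : v ≠ []) (hx : x ≠ [])
      (h : val x * val u ≤ val y * val v) : Rule (pos u ++ neg v) (neg x ++ pos y)
  | permutation₂ (u v x y : List M) (hu : u ≠ []) (hy : y ≠ [])
      (h : val v * val y ≤ val u * val x) : Rule (neg u ++ pos v) (pos x ++ neg y)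

/-- A basic inequality applied in a context. -/
inductive Step : List (M × Bool) → List (M × Bool) → Prop
  | intro (α β : List (M × Bool)) {ρ τ : List (M × Bool)} (h : Rule ρ τ) :
      Step (α ++ ρ ++ β) (α ++ τ ++ β)

/-- The reflexive transitive closure of the basic inequalities in contexts. -/
def GLE : List (M × Bool) → List (M × Bool) → Prop := Relation.ReflTransGen Step

theorem GLE.refl (α : List (M × Bool)) : GLE α α := Relation.ReflTransGen.refl

theorem GLE.trans {α β δ : List (M × Bool)} (h : GLE α β) (h' : GLE β δ) : GLE α δ :=
  Relation.ReflTransGen.trans h h'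

theorem GLE.of_rule {ρ τ : List (M × Bool)} (h : Rule ρ τ) : GLE ρ τ := by
  have := Step.intro [] [] h
  simp only [List.nil_append, List.append_nil] at this
  exact .single this

theorem GLE.context (α β : List (M × Bool)) {ρ τ : List (M × Bool)} (h : GLE ρ τ) :
    GLE (α ++ ρ ++ β) (α ++ τ ++ β) := by
  refine Relation.ReflTransGen.lift (fun ξ => α ++ ξ ++ β) ?_ _ _ h
  rintro _ _ ⟨α', β', h⟩
  have := Step.intro (α ++ α') (β' ++ β) h
  simpa only [Function.onFun, List.append_assoc] using this

theorem GLE.append {ρ τ ρ' τ' : List (M × Bool)} (h : GLE ρ τ) (h' : GLE ρ' τ') :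
    GLE (ρ ++ ρ') (τ ++ τ') := by
  have h1 := GLE.context [] ρ' h
  have h2 := GLE.context τ [] h'
  simp only [List.nil_append, List.append_nil] at h1 h2
  exact h1.trans h2

theorem GLE.pos_mono {w v : List M} (h : WordLE w v) : GLE (pos w) (pos v) := by
  obtain ⟨us, rfl, hu⟩ := h
  induction hu with
  | nil => exact .refl _
  | @cons x a us v hx _ ih =>
    have := (GLE.of_rule (Rule.posMono x a (FPlus.val_le_of hx))).append ih
    simpa [pos] using this

theorem GLE.letter_inv (p : M × Bool) : GLE [p, (p.1, !p.2)] [] ∧ GLE [] [p, (p.1, !p.2)] := by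
  obtain ⟨a, b⟩ := p
  cases b
  · have h1 := GLE.of_rule (Rule.contraction [a] [a] [] [] (by simp) (by simp [FPlus.val]))
    have h2 := GLE.of_rule (Rule.expansion [a] [a] [] [] (by simp) (by simp [FPlus.val]))
    simpa [pos, neg] using And.intro h1 h2
  · have h1 := GLE.of_rule (Rule.contraction [] [a] [a] [] (by simp) (by simp [FPlus.val]))
    have h2 := GLE.of_rule (Rule.expansion [] [a] [a] [] (by simp) (by simp [FPlus.val]))
    simpa [pos, neg] using And.intro h1 h2

theorem GLE.mul_inv (α : List (M × Bool)) :
    GLE (α ++ formalInv α) [] ∧ GLE [] (α ++ formalInv α) := by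
  induction α with
  | nil => exact ⟨.refl _, .refl _⟩
  | cons p t ih =>
    have e : (p :: t) ++ formalInv (p :: t) = [p] ++ (t ++ formalInv t) ++ [(p.1, !p.2)] := by
      simp [formalInv]
    have hp := GLE.letter_inv p
    have h1 := GLE.context [p] [(p.1, !p.2)] ih.1
    have h2 := GLE.context [p] [(p.1, !p.2)] ih.2
    rw [e]
    exact ⟨h1.trans (by simpa using hp.1), GLE.trans (by simpa using hp.2) h2⟩

theorem GLE.inv_mul (α : List (M × Bool)) :
    GLE (formalInv α ++ α) [] ∧ GLE [] (formalInv α ++ α) := by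
  simpa [formalInv_formalInv] using GLE.mul_inv (formalInv α)

theorem GLE.inv {α β : List (M × Bool)} (h : GLE α β) : GLE (formalInv β) (formalInv α) := by
  have h1 : GLE (formalInv β) (formalInv α ++ α ++ formalInv β) := by
    simpa using (GLE.inv_mul α).2.append (GLE.refl (formalInv β))
  have h2 := GLE.context (formalInv α) (formalInv β) h
  have h3 : GLE (formalInv α ++ β ++ formalInv β) (formalInv α) := by
    simpa using GLE.append (GLE.refl (formalInv α)) (GLE.mul_inv β).1
  exact (h1.trans h2).trans h3

instance : Preorder (GWord M) where
  le α β := GLE α.letters β.letters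
  le_refl _ := .refl _
  le_trans _ _ _ := .trans

variable (M) in
/-- The free pogroup over `FPlus M`: the partially ordered skeleton of the preordered monoid of
words in positive and negative letters. -/
def FreePogroup : Type u := Antisymmetrization (GWord M) (· ≤ ·)

instance : PartialOrder (FreePogroup M) :=
  inferInstanceAs (PartialOrder (Antisymmetrization (GWord M) (· ≤ ·)))

/-- The class of a word. -/
def FreePogroup.mk (α : List (M × Bool)) : FreePogroup M := toAntisymmetrization (· ≤ ·) ⟨α⟩

instance : Group (FreePogroup M) where
  mul := Quotient.map₂ (fun α β => ⟨α.letters ++ β.letters⟩)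
    fun _ _ h _ _ h' => ⟨h.1.append h'.1, h.2.append h'.2⟩
  one := FreePogroup.mk []
  inv := Quotient.map (fun α => ⟨formalInv α.letters⟩) fun _ _ h => ⟨h.2.inv, h.1.inv⟩
  mul_assoc := by
    rintro ⟨x⟩ ⟨y⟩ ⟨z⟩
    apply congrArg FreePogroup.mk
    simp
  one_mul := by
    rintro ⟨x⟩
    rfl
  mul_one := by
    rintro ⟨x⟩
    apply congrArg FreePogroup.mk
    simp
  inv_mul_cancel := by
    rintro ⟨x⟩
    exact le_antisymm (GLE.inv_mul x.letters).1 (GLE.inv_mul x.letters).2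

instance : MulLeftMono (FreePogroup M) where
  elim := by
    rintro ⟨x⟩ ⟨y⟩ ⟨z⟩ h
    exact GLE.append (.refl _) h

instance : MulRightMono (FreePogroup M) where
  elim := by
    rintro ⟨x⟩ ⟨y⟩ ⟨z⟩ h
    exact GLE.append h (.refl _)

theorem GLE.pos_one : GLE (pos [(1 : M)]) [] ∧ GLE [] (pos [(1 : M)]) := by
  have h1 : FPlus.of (1 : M) = 1 := rfl
  have e := GLE.of_rule (Rule.expansion [] [(1 : M)] [1] [1] (by simp)
    (by simp [FPlus.val, h1]))
  have c := GLE.of_rule (Rule.contraction [] [(1 : M)] [1] [] (by simp)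
    (by simp [FPlus.val]))
  have p := GLE.of_rule (Rule.posMono [] (1 : M) (by simp [FPlus.val, h1]))
  exact ⟨e.trans c, p⟩

variable (M) in
/-- The canonical homomorphism, which sends the class of a word to the class of this word. -/
def toFreePogroup : FPlus M →*o FreePogroup M where
  toFun := Quotient.map (fun w => ⟨pos w.letters⟩)
    fun _ _ h => ⟨GLE.pos_mono h.1, GLE.pos_mono h.2⟩
  map_one' := le_antisymm GLE.pos_one.1 GLE.pos_one.2
  map_mul' := by
    rintro ⟨x⟩ ⟨y⟩
    apply congrArg FreePogroup.mk
    simp [pos]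
  monotone' := by
    rintro ⟨x⟩ ⟨y⟩ h
    exact GLE.pos_mono h

end FreePogroup

end Pom

namespace Pom

/-! ### Positive and negative letters in words -/

section Words

variable {M : Type u}

/-! Part 1 is formal: every generating inequality of the preorder holds in any pogroup that receives
`FPlus M`, so evaluation of words is monotone, and letters determine the extension.

The substance is to decide when an element `n` of `FPlus M` lies below a word `α` in the free
pogroup. The preorder allows arbitrary detours through longer words, so it says little directly. The
relation `Below` replaces it by derivations without detours: a negative letter in `α a⁻¹ β` is
removed by choosing `y ≤ α` and `z ≤ β`, and then either some `x` with `a x ≤ z` and `n ≤ y x`, or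
some `x` with `x a ≤ y` and `n ≤ x z`. Soundness is immediate. Completeness
(`toFreePogroup_le_mk_iff`) is a form of cut elimination: each generating inequality is a composite
of a monotonicity step on positive words, insertions of pairs `u u⁻¹` or `u⁻¹ u`, and deletions of
such pairs. `Below.cut` covers the first two. Deletion rests on `Below.cancel_right`, which needs
`Below.exchange` and two facts about `FPlus M`: a word below a product splits along it, and, if `M`
is integrally closed, multiplication on the right reflects the order.

On positive words `Below` is just the order of `FPlus M`, so the canonical map is an order
embedding. If `M` is ideally residuated, so are its letters inside `FPlus M`, and the recursive
shape of `Below` shows that the elements of `FPlus M` below a given `α` form a non-empty finitely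
generated downset. Sending `g` to the downset that these elements generate in the group is the
required ideal conucleus.

For the equivalences, multiplication of words `FPlus M → M` is left adjoint to the singleton
embedding, which makes `M` a nuclear image of `FPlus M`. Conversely, in a group `a b ≤ c` means `b ≤
a⁻¹ c`, so the residuals in an ideal conuclear image are the open elements below a quotient. All the
properties concerned descend along nuclear images by `NuclearRetraction`. -/

theorem pos_append (u v : List M) : pos (u ++ v) = pos u ++ pos v := by simp [pos]

theorem neg_append (u v : List M) : neg (u ++ v) = neg v ++ neg u := by simp [neg]

theorem neg_cons (a : M) (u : List M) : neg (a :: u) = neg u ++ [(a, false)] := by simp [neg]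

theorem pos_reverse (u : List M) : (pos u).reverse = pos u.reverse := by simp [pos]

theorem pos_injective : Function.Injective (pos (M := M)) :=
  List.map_injective_iff.2 fun _ _ h => (Prod.mk.inj h).1

theorem not_mem_pos (a : M) (u : List M) : (a, false) ∉ pos u := by simp [pos]

theorem append_eq_pos {α β : List (M × Bool)} {w : List M} (h : α ++ β = pos w) :
    ∃ u v, w = u ++ v ∧ α = pos u ∧ β = pos v := by
  obtain ⟨u, v, rfl, rfl, rfl⟩ := List.append_eq_map_iff.1 h
  exact ⟨u, v, rfl, rfl, rfl⟩

theorem append_ne_pos {α β : List (M × Bool)} {a : M} {w : List M} :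
    α ++ (a, false) :: β ≠ pos w := fun h =>
  not_mem_pos a w (h ▸ by simp)

/-- A negative letter in `ξ ++ η` lies in `ξ` or in `η`. -/
theorem append_eq_append_neg {α β ξ η : List (M × Bool)} {a : M}
    (h : ξ ++ η = α ++ (a, false) :: β) :
    (∃ δ, ξ = α ++ (a, false) :: δ ∧ β = δ ++ η) ∨
      ∃ δ, η = δ ++ (a, false) :: β ∧ α = ξ ++ δ := by
  rcases List.append_eq_append_iff.1 h with ⟨δ, rfl, h2⟩ | ⟨δ, rfl, h2⟩
  · exact .inr ⟨δ, h2, rfl⟩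
  · rcases List.cons_eq_append_iff.1 h2 with ⟨rfl, h3⟩ | ⟨δ', rfl, rfl⟩
    · exact .inr ⟨[], by simpa using h3, by simp⟩
    · exact .inl ⟨δ', rfl, rfl⟩

/-- A negative letter in `ξ ++ pos u ++ η` lies in `ξ` or in `η`. -/
theorem append_pos_append_eq_append_neg {α β ξ η : List (M × Bool)} {u : List M} {a : M}
    (h : ξ ++ pos u ++ η = α ++ (a, false) :: β) :
    (∃ δ, ξ = α ++ (a, false) :: δ ∧ β = δ ++ pos u ++ η) ∨
      ∃ δ, η = δ ++ (a, false) :: β ∧ α = ξ ++ pos u ++ δ := by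
  rcases append_eq_append_neg h with ⟨δ, h1, rfl⟩ | ⟨δ, h1, rfl⟩
  · rcases append_eq_append_neg h1 with ⟨δ', h2, rfl⟩ | ⟨δ', h2, _⟩
    · exact .inl ⟨δ', h2, rfl⟩
    · exact absurd h2.symm append_ne_pos
  · exact .inr ⟨δ, h1, rfl⟩

end Words

/-! ### Derivations that eliminate negative letters -/

section Below

variable {M : Type u} {N : Type v} [Monoid N]

/-- The value in `N` of a word whose letters are interpreted by `ℓ`. -/
def wordVal (ℓ : M → N) (w : List M) : N := (w.map ℓ).prod

@[simp] theorem wordVal_nil (ℓ : M → N) : wordVal ℓ [] = 1 := rfl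

@[simp] theorem wordVal_cons (ℓ : M → N) (a : M) (w : List M) :
    wordVal ℓ (a :: w) = ℓ a * wordVal ℓ w := by simp [wordVal]

@[simp] theorem wordVal_append (ℓ : M → N) (w v : List M) :
    wordVal ℓ (w ++ v) = wordVal ℓ w * wordVal ℓ v := by simp [wordVal]

theorem wordVal_op (ℓ : M → N) (w : List M) :
    wordVal (MulOpposite.op ∘ ℓ) w = MulOpposite.op (wordVal ℓ w.reverse) := by
  induction w with
  | nil => rfl
  | cons a w ih => simp [ih]

variable [PartialOrder N]

/-- The letters `ℓ a` generate `N`, words in these letters split along every product above them,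
and `N` is integrally closed. -/
structure SplittingLetters (ℓ : M → N) : Prop where
  exists_word : ∀ n : N, ∃ w : List M, wordVal ℓ w = n
  split : ∀ (w : List M) (b c : N), wordVal ℓ w ≤ b * c →
    ∃ u v, w = u ++ v ∧ wordVal ℓ u ≤ b ∧ wordVal ℓ v ≤ c
  left_le_one : ∀ a x : N, a * x ≤ a → x ≤ 1
  right_le_one : ∀ a x : N, x * a ≤ a → x ≤ 1

/-- `Below ℓ n α` states that `n` lies below the word `α` in the free pogroup, as witnessed by a
derivation that eliminates the negative letters of `α` one at a time. -/
inductive Below (ℓ : M → N) : N → List (M × Bool) → Prop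
  | pos {n : N} (v : List M) (h : n ≤ wordVal ℓ v) : Below ℓ n (pos v)
  | left {n y z x : N} {a : M} {α β : List (M × Bool)} (hα : Below ℓ y α) (hβ : Below ℓ z β)
      (hx : ℓ a * x ≤ z) (hn : n ≤ y * x) : Below ℓ n (α ++ (a, false) :: β)
  | right {n y z x : N} {a : M} {α β : List (M × Bool)} (hα : Below ℓ y α) (hβ : Below ℓ z β)
      (hx : x * ℓ a ≤ y) (hn : n ≤ x * z) : Below ℓ n (α ++ (a, false) :: β)

variable {ℓ : M → N}

namespace Below

theorem anti {m n : N} {α : List (M × Bool)} (h : Below ℓ n α) (hm : m ≤ n) : Below ℓ m α := by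
  cases h with
  | pos v h => exact .pos v (hm.trans h)
  | left hα hβ hx hn => exact .left hα hβ hx (hm.trans hn)
  | right hα hβ hx hn => exact .right hα hβ hx (hm.trans hn)

/-- Both elimination rules produce a negative letter, so only the base rule can end in a positive
word. This is what makes the canonical map an order embedding. -/
theorem le_wordVal {n : N} {v : List M} (h : Below ℓ n (Pom.pos v)) : n ≤ wordVal ℓ v := by
  generalize e : Pom.pos v = α at h
  cases h with
  | pos v' h => rwa [pos_injective e]
  | left => exact absurd e.symm append_ne_pos
  | right => exact absurd e.symm append_ne_pos

theorem one_nil : Below ℓ (1 : N) [] := .pos [] (by simp)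

theorem append_neg {n : N} {c : List M} {α : List (M × Bool)} (h : Below ℓ (n * wordVal ℓ c) α) :
    Below ℓ n (α ++ neg c) := by
  induction c generalizing n with
  | nil => simpa [neg] using h
  | cons a c ih =>
    rw [neg_cons, ← List.append_assoc]
    refine .right (ih (n := n * ℓ a) ?_) one_nil le_rfl (by simp)
    simpa [mul_assoc] using h

theorem neg_append {n : N} {c : List M} {α : List (M × Bool)} (h : Below ℓ (wordVal ℓ c * n) α) :
    Below ℓ n (neg c ++ α) := by
  induction c generalizing n α with
  | nil => simpa [neg] using h
  | cons a c ih =>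
    rw [neg_cons, List.append_assoc]
    refine ih (.left (α := []) one_nil h ?_ (one_mul _).ge)
    simp [mul_assoc]

theorem op {n : N} {α : List (M × Bool)} (h : Below ℓ n α) :
    Below (MulOpposite.op ∘ ℓ) (MulOpposite.op n) α.reverse := by
  induction h with
  | pos v h =>
    rw [pos_reverse]
    exact .pos _ (by rw [wordVal_op, List.reverse_reverse]; exact h)
  | left _ _ hx hn ihα ihβ =>
    rw [List.reverse_append, List.reverse_cons, List.append_assoc, List.singleton_append]
    exact .right ihβ ihα hx hn
  | right _ _ hx hn ihα ihβ =>
    rw [List.reverse_append, List.reverse_cons, List.append_assoc, List.singleton_append]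
    exact .left ihβ ihα hx hn

theorem unop {n : Nᵐᵒᵖ} {α : List (M × Bool)} (h : Below (MulOpposite.op ∘ ℓ) n α) :
    Below ℓ n.unop α.reverse := by
  induction h with
  | pos v h =>
    rw [pos_reverse]
    exact .pos _ (by rw [wordVal_op] at h; exact h)
  | left _ _ hx hn ihα ihβ =>
    rw [List.reverse_append, List.reverse_cons, List.append_assoc, List.singleton_append]
    exact .right ihβ ihα hx hn
  | right _ _ hx hn ihα ihβ =>
    rw [List.reverse_append, List.reverse_cons, List.append_assoc, List.singleton_append]
    exact .left ihβ ihα hx hn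

variable [MulLeftMono N] [MulRightMono N]

/-- In the elimination rules for the left factor, the right factor is absorbed into the part after
the eliminated letter, where `a x ≤ z` gives `a (x n) ≤ z n`. For a positive left factor the
induction passes to the right factor symmetrically. -/
theorem mul {m n : N} {α β : List (M × Bool)} (hm : Below ℓ m α) (hn : Below ℓ n β) :
    Below ℓ (m * n) (α ++ β) := by
  induction hm with
  | pos v h =>
    induction hn with
    | pos v' h' =>
      rw [← pos_append]
      exact .pos _ (by simpa using mul_le_mul' h h')
    | @left n y z x a α β hα hβ hx hn ihα ihβ =>
      rw [← List.append_assoc]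
      exact .left ihα hβ hx (by rw [mul_assoc]; exact mul_le_mul' le_rfl hn)
    | @right n y z x a α β hα hβ hx hn ihα ihβ =>
      rw [← List.append_assoc]
      exact .right ihα hβ (by rw [mul_assoc]; exact mul_le_mul' le_rfl hx)
        (by rw [mul_assoc]; exact mul_le_mul' le_rfl hn)
  | left hα hβ hx hm ihα ihβ =>
    rw [List.append_assoc, List.cons_append]
    exact .left hα ihβ (by rw [← mul_assoc]; exact mul_le_mul' hx le_rfl)
      (by rw [← mul_assoc]; exact mul_le_mul' hm le_rfl)
  | right hα hβ hx hm ihα ihβ =>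
    rw [List.append_assoc, List.cons_append]
    exact .right hα ihβ hx (by rw [← mul_assoc]; exact mul_le_mul' hm le_rfl)

/-- An eliminated negative letter never lies in the positive block `u`, so the block survives intact
on one side of it. The substitution thus moves up to the base rule, where it is `mul`. -/
theorem cut {n : N} {α β γ : List (M × Bool)} {u : List M}
    (h : Below ℓ n (α ++ Pom.pos u ++ β)) (hu : Below ℓ (wordVal ℓ u) γ) :
    Below ℓ n (α ++ γ ++ β) := by
  generalize e : α ++ Pom.pos u ++ β = δ at h
  induction h generalizing α β with
  | pos v h =>
    obtain ⟨v', v₃, rfl, e', rfl⟩ := append_eq_pos e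
    obtain ⟨v₁, v₂, rfl, rfl, e''⟩ := append_eq_pos e'
    obtain rfl := pos_injective e''
    refine anti ((mul (mul (.pos v₁ le_rfl) hu) (.pos v₃ le_rfl))) (by simpa [mul_assoc] using h)
  | left hα hβ hx hn ihα ihβ =>
    rcases append_pos_append_eq_append_neg e with ⟨δ, rfl, rfl⟩ | ⟨δ, rfl, rfl⟩
    · simpa using Below.left hα (ihβ rfl) hx hn
    · simpa using Below.left (ihα rfl) hβ hx hn
  | right hα hβ hx hn ihα ihβ =>
    rcases append_pos_append_eq_append_neg e with ⟨δ, rfl, rfl⟩ | ⟨δ, rfl, rfl⟩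
    · simpa using Below.right hα (ihβ rfl) hx hn
    · simpa using Below.right (ihα rfl) hβ hx hn

theorem insert {n : N} {α β γ : List (M × Bool)} (h : Below ℓ n (α ++ β)) (hγ : Below ℓ 1 γ) :
    Below ℓ n (α ++ γ ++ β) :=
  cut (u := []) (by simpa [Pom.pos] using h) (by simpa using hγ)

end Below

instance [MulRightMono N] : MulLeftMono Nᵐᵒᵖ where
  elim a _ _ h := mul_le_mul_left (α := N) h a.unop

instance [MulLeftMono N] : MulRightMono Nᵐᵒᵖ where
  elim a _ _ h := mul_le_mul_right (α := N) h a.unop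

/-! ### Consequences of splitting and integral closedness -/

namespace SplittingLetters

/-- The hypotheses are left-right symmetric, so each result about derivations has a mirror image;
this is why `N` and `ℓ` are kept abstract. -/
theorem op (hℓ : SplittingLetters ℓ) : SplittingLetters (MulOpposite.op ∘ ℓ) where
  exists_word n := by
    obtain ⟨w, hw⟩ := hℓ.exists_word n.unop
    exact ⟨w.reverse, by simp [wordVal_op, hw]⟩
  split w b c h := by
    rw [wordVal_op] at h
    obtain ⟨u, v, e, hu, hv⟩ := hℓ.split w.reverse c.unop b.unop h
    refine ⟨v.reverse, u.reverse, ?_, ?_, ?_⟩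
    · rw [← List.reverse_append, ← e, List.reverse_reverse]
    · rw [wordVal_op, List.reverse_reverse]; exact hv
    · rw [wordVal_op, List.reverse_reverse]; exact hu
  left_le_one a x h := hℓ.right_le_one a.unop x.unop h
  right_le_one a x h := hℓ.left_le_one a.unop x.unop h

/-- The splitting of a product of two words below a product. -/
theorem split_append (hℓ : SplittingLetters ℓ) {y x : List M} {b c : N}
    (h : wordVal ℓ y * wordVal ℓ x ≤ b * c) :
    (∃ y₁ y₂, y = y₁ ++ y₂ ∧ wordVal ℓ y₁ ≤ b ∧ wordVal ℓ y₂ * wordVal ℓ x ≤ c) ∨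
      ∃ x₁ x₂, x = x₁ ++ x₂ ∧ wordVal ℓ y * wordVal ℓ x₁ ≤ b ∧ wordVal ℓ x₂ ≤ c := by
  rw [← wordVal_append] at h
  obtain ⟨p, q, e, hp, hq⟩ := hℓ.split _ _ _ h
  rcases List.append_eq_append_iff.1 e with ⟨δ, rfl, rfl⟩ | ⟨δ, rfl, rfl⟩
  · exact .inr ⟨δ, q, rfl, by simpa using hp, hq⟩
  · exact .inl ⟨p, δ, rfl, hp, by simpa using hq⟩

/-- Splitting `q = q₁ q₂` along `e q` gives `q₁ ≤ e` and `q₂ ≤ q₁ q₂`. Either `q₁` is empty and `1 ≤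
e`, or the same situation recurs with the shorter word `q₂` and with `q₁` for `e`. -/
theorem one_le_of_le_mul (hℓ : SplittingLetters ℓ) {e : N} {q : List M}
    (h : wordVal ℓ q ≤ e * wordVal ℓ q) : 1 ≤ e := by
  induction hk : q.length using Nat.strong_induction_on generalizing e q with
  | _ k ih =>
    obtain ⟨q₁, q₂, rfl, h₁, h₂⟩ := hℓ.split _ _ _ h
    cases q₁ with
    | nil => simpa using h₁
    | cons a t =>
      refine le_trans (ih q₂.length ?_ (e := wordVal ℓ (a :: t)) (q := q₂) ?_ rfl) h₁
      · subst hk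
        simp
      · simpa [mul_assoc] using h₂

variable [MulLeftMono N] [MulRightMono N]

/-- If the split of `y x ≤ m x` falls inside `y = y₁ y₂`, then `y₂ x ≤ x` and integral closedness
gives `y₂ ≤ 1`. If it falls inside `x = x₁ x₂`, then `x₂ ≤ x₁ x₂` gives `1 ≤ x₁`, and `y ≤ y x₁ ≤
m`. -/
theorem le_of_mul_le_mul_right (hℓ : SplittingLetters ℓ) {n m x : N} (h : n * x ≤ m * x) :
    n ≤ m := by
  obtain ⟨y, rfl⟩ := hℓ.exists_word n
  obtain ⟨x, rfl⟩ := hℓ.exists_word x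
  rcases hℓ.split_append h with ⟨y₁, y₂, rfl, h₁, h₂⟩ | ⟨x₁, x₂, rfl, h₁, h₂⟩
  · rw [wordVal_append]
    exact (mul_le_mul' h₁ (hℓ.right_le_one _ _ h₂)).trans_eq (mul_one m)
  · rw [wordVal_append] at h₂
    have := hℓ.one_le_of_le_mul h₂
    calc wordVal ℓ y = wordVal ℓ y * 1 := (mul_one _).symm
      _ ≤ _ := mul_le_mul' le_rfl this
      _ ≤ m := h₁

end SplittingLetters

/-! ### Admissibility of deleting inverse pairs -/

namespace Below

variable [MulLeftMono N] [MulRightMono N]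

/-- If `c ≤ α x` and `y x ≤ δ`, then `y ≤ δ c⁻¹ α`. -/
theorem exchange (hℓ : SplittingLetters ℓ) {n y : N} {c x : List M} {α δ : List (M × Bool)}
    (h : Below ℓ n (α ++ Pom.pos x)) (hc : wordVal ℓ c ≤ n) (hδ : Below ℓ (y * wordVal ℓ x) δ) :
    Below ℓ y (δ ++ neg c ++ α) := by
  generalize e : α ++ Pom.pos x = ξ at h
  induction h generalizing α c with
  | pos v h =>
    obtain ⟨v, x', rfl, rfl, e'⟩ := append_eq_pos e
    obtain rfl := pos_injective e'
    rw [wordVal_append] at h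
    -- Here `c₁ ≤ v` gives `1 ≤ c₁⁻¹ v`, and `c₂ ≤ x` gives `y c₂ ≤ δ`, that is `y ≤ δ c₂⁻¹`.
    obtain ⟨c₁, c₂, rfl, h₁, h₂⟩ := hℓ.split _ _ _ (hc.trans h)
    have k₁ : Below ℓ y (δ ++ neg c₂) := append_neg (hδ.anti (mul_le_mul' le_rfl h₂))
    have k₂ : Below ℓ 1 (neg c₁ ++ Pom.pos v) := neg_append (.pos v (by simpa using h₁))
    simpa [Pom.neg_append] using mul k₁ k₂
  | @left n y' z t a α' β hα hβ hx hn ihα ihβ =>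
    rcases append_eq_append_neg e with ⟨α₂, rfl, rfl⟩ | ⟨_, h, _⟩
    · obtain ⟨c₁, c₂, rfl, h₁, h₂⟩ := hℓ.split _ _ _ (hc.trans hn)
      -- The induction hypothesis yields `y ≤ δ c₂⁻¹ a⁻¹ α₂`. Inserting `c₁⁻¹ α'`, which lies above
      -- `1`, before `a⁻¹` gives the claim.
      have k := ihβ (c := a :: c₂) (by simpa using (mul_le_mul' le_rfl h₂).trans hx) rfl
      have k₁ : Below ℓ 1 (neg c₁ ++ α') := neg_append (hα.anti (by simpa using h₁))
      rw [neg_cons] at k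
      simpa [Pom.neg_append] using insert (α := δ ++ neg c₂) (β := [(a, false)] ++ α₂)
        (by simpa using k) k₁
    · exact absurd h.symm append_ne_pos
  | @right n y' z t a α' β hα hβ hx hn ihα ihβ =>
    rcases append_eq_append_neg e with ⟨α₂, rfl, rfl⟩ | ⟨_, h, _⟩
    · obtain ⟨c₁, c₂, rfl, h₁, h₂⟩ := hℓ.split _ _ _ (hc.trans hn)
      have k := ihβ (c := c₂) h₂ rfl
      have k₁ : Below ℓ 1 (neg c₁ ++ (α' ++ neg [a])) := by
        refine neg_append (append_neg (hα.anti ?_))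
        simpa using (mul_le_mul' h₁ le_rfl).trans hx
      simpa [Pom.neg_append, neg] using insert (α := δ ++ neg c₂) (β := α₂) k k₁
    · exact absurd h.symm append_ne_pos

/-- Induction on the derivation, splitting `y x` along the product in its last rule. A split inside
`y` preserves the rule. A split inside `x` distributes `x` over both sides of the eliminated letter,
which is the situation that `exchange` resolves. -/
theorem cancel_right (hℓ : SplittingLetters ℓ) {n y : N} {x : List M} {α : List (M × Bool)}
    (h : Below ℓ n (α ++ Pom.pos x)) (hy : y * wordVal ℓ x ≤ n) : Below ℓ y α := by
  generalize e : α ++ Pom.pos x = ξ at h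
  induction h generalizing α x y with
  | pos v h =>
    obtain ⟨v, x', rfl, rfl, e'⟩ := append_eq_pos e
    obtain rfl := pos_injective e'
    rw [wordVal_append] at h
    exact .pos v (hℓ.le_of_mul_le_mul_right (hy.trans h))
  | @left n y' z t a α' β hα hβ hx hn ihα ihβ =>
    rcases append_eq_append_neg e with ⟨α₂, rfl, rfl⟩ | ⟨_, h, _⟩
    · obtain ⟨y, rfl⟩ := hℓ.exists_word y
      rcases hℓ.split_append (hy.trans hn) with ⟨y₁, y₂, rfl, h₁, h₂⟩ | ⟨x₁, x₂, rfl, h₁, h₂⟩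
      · have k := ihβ (y := ℓ a * wordVal ℓ y₂)
          (by rw [mul_assoc]; exact (mul_le_mul' le_rfl h₂).trans hx) rfl
        exact .left hα k le_rfl (by rw [wordVal_append]; exact mul_le_mul' h₁ le_rfl)
      · have k := ihβ (y := ℓ a) (x := x₂) (α := α₂ ++ Pom.pos x₁)
          ((mul_le_mul' le_rfl h₂).trans hx) (by simp [pos_append])
        simpa [neg] using exchange hℓ (c := [a]) k (by simp) (hα.anti h₁)
    · exact absurd h.symm append_ne_pos
  | @right n y' z t a α' β hα hβ hx hn ihα ihβ =>
    rcases append_eq_append_neg e with ⟨α₂, rfl, rfl⟩ | ⟨_, h, _⟩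
    · obtain ⟨y, rfl⟩ := hℓ.exists_word y
      rcases hℓ.split_append (hy.trans hn) with ⟨y₁, y₂, rfl, h₁, h₂⟩ | ⟨x₁, x₂, rfl, h₁, h₂⟩
      · exact .right hα (ihβ h₂ rfl) ((mul_le_mul' h₁ le_rfl).trans hx) (wordVal_append ..).le
      · have k := ihβ (y := 1) (x := x₂) (α := α₂ ++ Pom.pos x₁)
          (by simpa using h₂) (by simp [pos_append])
        have k' : Below ℓ (wordVal ℓ y * wordVal ℓ x₁) (α' ++ neg [a]) :=
          append_neg (hα.anti (by simpa using (mul_le_mul' h₁ le_rfl).trans hx))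
        simpa [neg] using exchange hℓ (c := []) k (by simp) k'
    · exact absurd h.symm append_ne_pos

/-- Deletion of an adjacent pair `a a⁻¹`. -/
theorem delete_pos_neg (hℓ : SplittingLetters ℓ) {n : N} {α β : List (M × Bool)} {a : M}
    (h : Below ℓ n (α ++ Pom.pos [a] ++ (a, false) :: β)) : Below ℓ n (α ++ β) := by
  generalize e : α ++ Pom.pos [a] ++ (a, false) :: β = ξ at h
  induction h generalizing α β with
  | pos v h => exact absurd e append_ne_pos
  | @left n y z t b α' β' hα hβ hx hn ihα ihβ =>
    rcases append_pos_append_eq_append_neg e with ⟨δ, rfl, rfl⟩ | ⟨δ, h, rfl⟩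
    · simpa using Below.left hα (ihβ rfl) hx hn
    · rcases List.cons_eq_append_iff.1 h with ⟨rfl, h'⟩ | ⟨δ, rfl, rfl⟩
      · obtain ⟨⟨rfl, -⟩, rfl⟩ := by simpa using h'
        obtain ⟨t, rfl⟩ := hℓ.exists_word t
        rw [List.append_nil] at hα
        -- From `y ≤ α a` follows `y t ≤ α a t`; since `a t ≤ z ≤ β`, the block `a t` can be cut
        -- against `β`.
        have k : Below ℓ (y * wordVal ℓ t) (α ++ Pom.pos (a :: t) ++ []) := by
          simpa [Pom.pos] using mul hα (.pos t le_rfl)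
        simpa using (cut k (hβ.anti (by simpa using hx))).anti hn
      · simpa using Below.left (ihα (by simp)) hβ hx hn
  | @right n y z t b α' β' hα hβ hx hn ihα ihβ =>
    rcases append_pos_append_eq_append_neg e with ⟨δ, rfl, rfl⟩ | ⟨δ, h, rfl⟩
    · simpa using Below.right hα (ihβ rfl) hx hn
    · rcases List.cons_eq_append_iff.1 h with ⟨rfl, h'⟩ | ⟨δ, rfl, rfl⟩
      · obtain ⟨⟨rfl, -⟩, rfl⟩ := by simpa using h'
        rw [List.append_nil] at hα
        -- Here `t a ≤ y ≤ α a`, so cancelling `a` leaves `t ≤ α`.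
        exact (mul (cancel_right hℓ hα (by simpa using hx)) hβ).anti hn
      · simpa using Below.right (ihα (by simp)) hβ hx hn

/-- Deletion of an adjacent pair `a⁻¹ a`. -/
theorem delete_neg_pos (hℓ : SplittingLetters ℓ) {n : N} {α β : List (M × Bool)} {a : M}
    (h : Below ℓ n (α ++ (a, false) :: Pom.pos [a] ++ β)) : Below ℓ n (α ++ β) := by
  -- Reversal turns `a⁻¹ a` into `a a⁻¹`.
  have h' := h.op
  have k := delete_pos_neg hℓ.op (n := MulOpposite.op n) (α := β.reverse) (β := α.reverse) (a := a)
    (by simpa [Pom.pos] using h')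
  simpa using k.unop

end Below

end Below

/-! ### Finitely generated downsets -/

section FinitelyGenerated

variable {P : Type u} [PartialOrder P]

/-- The set is a possibly empty finitely generated downset. -/
def IsFG (S : Set P) : Prop := ∃ F : Set P, F.Finite ∧ ∀ x, x ∈ S ↔ ∃ f ∈ F, x ≤ f

theorem IsFG.empty : IsFG (∅ : Set P) := ⟨∅, Set.finite_empty, by simp⟩

theorem IsFG.Iic (a : P) : IsFG (Set.Iic a) := ⟨{a}, Set.finite_singleton a, by simp⟩

theorem IsFG.union {S T : Set P} (hS : IsFG S) (hT : IsFG T) : IsFG (S ∪ T) := by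
  obtain ⟨F, hF, hS⟩ := hS
  obtain ⟨G, hG, hT⟩ := hT
  refine ⟨F ∪ G, hF.union hG, fun x => ?_⟩
  rw [Set.mem_union, hS, hT]
  simp only [Set.mem_union, or_and_right, exists_or]

theorem IsFG.biUnion {ι : Type*} {I : Set ι} (hI : I.Finite) {S : ι → Set P}
    (hS : ∀ i ∈ I, IsFG (S i)) : IsFG (⋃ i ∈ I, S i) := by
  induction I, hI using Set.Finite.induction_on with
  | empty => simpa using IsFG.empty
  | @insert i I _ _ ih =>
    rw [Set.biUnion_insert]
    exact (hS i (Set.mem_insert i I)).union (ih fun j hj => hS j (Set.mem_insert_of_mem i hj))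

/-- Substitution of the generators of `S` in a family of downsets that depends monotonically on
its parameter. -/
theorem IsFG.bind {Q : Type v} [PartialOrder Q] {S : Set P} (hS : IsFG S) {R : P → Set Q}
    (hR : ∀ p, IsFG (R p)) (hmono : ∀ p q, p ≤ q → R p ⊆ R q) :
    IsFG {x | ∃ p ∈ S, x ∈ R p} := by
  obtain ⟨F, hF, hS⟩ := hS
  convert IsFG.biUnion hF (S := R) fun p _ => hR p using 1
  ext x
  simp only [Set.mem_ofPred_eq, Set.mem_iUnion, exists_prop]
  constructor
  · rintro ⟨p, hp, hx⟩
    obtain ⟨f, hf, hpf⟩ := (hS p).1 hp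
    exact ⟨f, hf, hmono p f hpf hx⟩
  · rintro ⟨f, hf, hx⟩
    exact ⟨f, (hS f).2 ⟨f, hf, le_rfl⟩, hx⟩

theorem IsFG.mul {N : Type u} [Monoid N] [PartialOrder N] [MulLeftMono N] [MulRightMono N]
    {S T : Set N} (hS : IsFG S) (hT : IsFG T) : IsFG {z | ∃ x ∈ S, ∃ y ∈ T, z ≤ x * y} := by
  refine hS.bind (R := fun x => {z | ∃ y ∈ T, z ≤ x * y}) (fun x => ?_) ?_
  · exact hT.bind (R := fun y => Set.Iic (x * y)) (fun y => IsFG.Iic _) fun y y' h z hz =>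
      le_trans hz (mul_le_mul_right h x)
  · rintro x x' h z ⟨y, hy, hz⟩
    exact ⟨y, hy, hz.trans (mul_le_mul_left h y)⟩

end FinitelyGenerated

/-! ### The elements below a word form a finitely generated downset -/

namespace Below

variable {M : Type u} {N : Type v} [Monoid N] [PartialOrder N] {ℓ : M → N}

/-- A product of lower bounds of the letters works: `a` itself for a positive letter, any `x` with
`a x ≤ 1` for a negative one. -/
theorem exists_below (hL : ∀ a, ∃ x, ℓ a * x ≤ 1) (α : List (M × Bool))
    [MulLeftMono N] [MulRightMono N] : ∃ n, Below ℓ n α := by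
  induction α with
  | nil => exact ⟨1, one_nil⟩
  | cons p α ih =>
    obtain ⟨n, hn⟩ := ih
    rcases p with ⟨a, _ | _⟩
    · obtain ⟨x, hx⟩ := hL a
      have k : Below ℓ x [(a, false)] := .left (α := []) one_nil one_nil hx (one_mul x).ge
      exact ⟨_, mul k hn⟩
    · exact ⟨_, mul (.pos [a] le_rfl) hn⟩

/-- The last rule of a derivation is determined up to finitely many choices: none for a positive
word, otherwise the position of the eliminated letter and its side. For each choice the bounds come
from those of two shorter words by residuation with one letter and multiplication. -/
theorem isFG [MulLeftMono N] [MulRightMono N] (hL : ∀ a n, IsFG {x | ℓ a * x ≤ n})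
    (hR : ∀ a n, IsFG {x | x * ℓ a ≤ n}) (α : List (M × Bool)) : IsFG {n | Below ℓ n α} := by
  induction hk : α.length using Nat.strong_induction_on generalizing α with
  | _ k ih =>
  have e : {n | Below ℓ n α} = {n | ∃ v, α = Pom.pos v ∧ n ≤ wordVal ℓ v} ∪
      ⋃ i ∈ Set.Iio α.length, {n | ∃ a α' β', i = α'.length ∧ α = α' ++ (a, false) :: β' ∧
        ((∃ y, Below ℓ y α' ∧ ∃ x, (∃ z, Below ℓ z β' ∧ ℓ a * x ≤ z) ∧ n ≤ y * x) ∨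
          ∃ x, (∃ y, Below ℓ y α' ∧ x * ℓ a ≤ y) ∧ ∃ z, Below ℓ z β' ∧ n ≤ x * z)} := by
    ext n
    simp only [Set.mem_ofPred_eq, Set.mem_union, Set.mem_iUnion, Set.mem_Iio, exists_prop]
    constructor
    · rintro (⟨v, h⟩ | @⟨_, y, z, x, a, α, β, hα, hβ, hx, hn⟩ |
        @⟨_, y, z, x, a, α, β, hα, hβ, hx, hn⟩)
      · exact .inl ⟨v, rfl, h⟩
      · exact .inr ⟨α.length, by simp, a, α, β, rfl, rfl, .inl ⟨y, hα, x, ⟨z, hβ, hx⟩, hn⟩⟩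
      · exact .inr ⟨α.length, by simp, a, α, β, rfl, rfl, .inr ⟨x, ⟨y, hα, hx⟩, z, hβ, hn⟩⟩
    · rintro (⟨v, rfl, h⟩ | ⟨_, _, a, α, β, rfl, rfl, ⟨y, hα, x, ⟨z, hβ, hx⟩, hn⟩ |
        ⟨x, ⟨y, hα, hx⟩, z, hβ, hn⟩⟩)
      · exact .pos v h
      · exact .left hα hβ hx hn
      · exact .right hα hβ hx hn
  rw [e]
  refine .union ?_ (.biUnion (Set.finite_Iio _) fun i _ => ?_)
  · by_cases h : ∃ v, α = Pom.pos v
    · obtain ⟨v, rfl⟩ := h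
      convert IsFG.Iic (wordVal ℓ v) using 1
      ext n
      constructor
      · rintro ⟨v', e, h⟩
        obtain rfl := pos_injective e
        exact h
      · exact fun h => ⟨v, rfl, h⟩
    · convert IsFG.empty using 1
      exact Set.eq_empty_of_forall_notMem fun n ⟨v, hv, _⟩ => h ⟨v, hv⟩
  · by_cases h : ∃ a α' β', i = α'.length ∧ α = α' ++ (a, false) :: β'
    · obtain ⟨a, α', β', rfl, rfl⟩ := h
      have h₁ := ih _ (by subst hk; simp) α' rfl
      have h₂ := ih _ (by subst hk; simp; omega) β' rfl
      -- The possible `x` of the rules `left` and `right`: residuals of the downsets below `β'` and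
      -- `α'` by the letter `a`.
      have k₁ := h₂.bind (R := fun z => {x | ℓ a * x ≤ z}) (hL a) fun _ _ h _ hx => le_trans hx h
      have k₂ := h₁.bind (R := fun z => {x | x * ℓ a ≤ z}) (hR a) fun _ _ h _ hx => le_trans hx h
      convert (h₁.mul k₁).union (k₂.mul h₂) using 1
      ext n
      constructor
      · rintro ⟨a', α'', β'', hl, e, h⟩
        obtain ⟨rfl, e'⟩ := List.append_inj e hl
        obtain ⟨⟨rfl, -⟩, rfl⟩ := by simpa using e'
        exact h
      · exact fun h => ⟨a, α', β', rfl, rfl, h⟩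
    · convert IsFG.empty using 1
      exact Set.eq_empty_of_forall_notMem fun n ⟨a, α', β', hl, he, _⟩ => h ⟨a, α', β', hl, he⟩

end Below

/-! ### Splitting, adjunction and residuals in the free unital nuclear preimage -/

section FPlusFacts

variable {M : Type u} [Monoid M] [PartialOrder M] [MulLeftMono M] [MulRightMono M]

namespace FPlus

theorem val_nil : val ([] : List M) = 1 := rfl

theorem val_singleton (a : M) : val [a] = of a := by simp [val]

theorem val_mono {w v : List M} (h : WordLE w v) : val w ≤ val v := by
  obtain ⟨us, rfl, hu⟩ := h
  induction hu with
  | nil => exact le_rfl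
  | cons h _ ih =>
    rw [List.flatten_cons, val_append, val_cons]
    exact mul_le_mul' (val_le_of h) ih

theorem exists_mk (n : FPlus M) : ∃ w, mk w = n := by
  obtain ⟨w⟩ := n
  exact ⟨w, rfl⟩

theorem exists_val (n : FPlus M) : ∃ w, val w = n := by
  obtain ⟨w, rfl⟩ := exists_mk n
  exact ⟨_, val_eq_mk w⟩

theorem val_split (w : List M) (b c : FPlus M) (h : val w ≤ b * c) :
    ∃ u v, w = u ++ v ∧ val u ≤ b ∧ val v ≤ c := by
  obtain ⟨b, rfl⟩ := exists_mk b
  obtain ⟨c, rfl⟩ := exists_mk c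
  have key : ∀ w : NEWord M, mk w ≤ mk b * mk c →
      ∃ u v, w.letters = u ++ v ∧ val u ≤ mk b ∧ val v ≤ mk c := fun w h => by
    obtain ⟨x, x', e, hx, hx'⟩ := WordLE.of_append (v := b.letters) (v' := c.letters) h
    refine ⟨x, x', e, ?_, ?_⟩
    · rw [← val_eq_mk]; exact val_mono hx
    · rw [← val_eq_mk]; exact val_mono hx'
  rcases eq_or_ne w [] with rfl | hw
  -- The empty word is represented by `[1]`. When `[1]` is cut in two, each piece is `[]` or `[1]`,
  -- and both of these have value `1`.
  · obtain ⟨u, v, e, hu, hv⟩ := key ⟨[1], by simp⟩ h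
    refine ⟨[], [], rfl, ?_, ?_⟩
    · refine le_trans ?_ hu
      rcases List.singleton_eq_append_iff.1 e with ⟨rfl, _⟩ | ⟨rfl, _⟩
      · exact le_rfl
      · rw [val_singleton]; exact le_rfl
    · refine le_trans ?_ hv
      rcases List.singleton_eq_append_iff.1 e with ⟨_, rfl⟩ | ⟨_, rfl⟩
      · rw [val_singleton]; exact le_rfl
      · exact le_rfl
  · exact key ⟨w, hw⟩ (by rwa [← val_eq_mk ⟨w, hw⟩])

variable (M) in
/-- The multiplication map, which sends the class of a word to its product in `M`. -/
def prod : FPlus M →*o M where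
  toFun := Quotient.lift (fun w => w.letters.prod) fun _ _ h => le_antisymm h.1.prod_le h.2.prod_le
  map_one' := List.prod_singleton
  map_mul' := by
    rintro ⟨x⟩ ⟨y⟩
    exact List.prod_append
  monotone' := by
    rintro ⟨x⟩ ⟨y⟩ h
    exact WordLE.prod_le h

theorem prod_of (a : M) : prod M (of a) = a := List.prod_singleton

/-- The adjunction that exhibits `M` as a nuclear image of `FPlus M`. As the unit is `of 1`, it also
says that `prod` detects the elements below the unit. -/
theorem le_of_iff {n : FPlus M} {a : M} : n ≤ of a ↔ prod M n ≤ a := by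
  constructor
  · intro h
    simpa [prod_of] using (prod M).monotone' h
  · intro h
    obtain ⟨w, rfl⟩ := exists_mk n
    rw [← val_eq_mk]
    exact val_le_of h

theorem of_mono {a b : M} (h : a ≤ b) : of a ≤ of b := le_of_iff.2 (by rwa [prod_of])

theorem le_one_iff {n : FPlus M} : n ≤ 1 ↔ prod M n ≤ 1 := le_of_iff (a := 1)

theorem integrallyClosed (h : IntegrallyClosed M) : IntegrallyClosed (FPlus M) := by
  refine fun a x => ⟨fun k => le_one_iff.2 ((h (prod M a) _).1 ?_),
    fun k => le_one_iff.2 ((h (prod M a) _).2 ?_)⟩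
  · simpa using (prod M).monotone' k
  · simpa using (prod M).monotone' k

theorem splittingLetters (h : IntegrallyClosed M) : SplittingLetters (of (M := M)) where
  exists_word := exists_val
  split := val_split
  left_le_one a x := (integrallyClosed h a x).1
  right_le_one a x := (integrallyClosed h a x).2

/-- The word `[a] ∘ x` splits along `[b] ∘ n`. Either the first block is empty, which requires `1 ≤
b`, or it starts with `a` and takes a prefix `e` of `x` with it. Residuals by a letter in `FPlus M`
are thereby computed recursively from residuals in `M`. -/
theorem of_mul_le_of_mul_iff {a b : M} {x n : FPlus M} : of a * x ≤ of b * n ↔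
    (1 ≤ b ∧ of a * x ≤ n) ∨ ∃ e, a * prod M e ≤ b ∧ ∃ q ≤ n, x ≤ e * q := by
  constructor
  · intro h
    obtain ⟨w, rfl⟩ := exists_val x
    rw [← val_cons] at h
    obtain ⟨u, v, e, hu, hv⟩ := val_split _ _ _ h
    cases u with
    | nil =>
      refine .inl ⟨by simpa [val_nil, le_of_iff] using hu, ?_⟩
      rwa [← val_cons, e]
    | cons a' t =>
      obtain ⟨rfl, rfl⟩ := by simpa using e
      refine .inr ⟨val t, ?_, val v, hv, (val_append t v).le⟩
      simpa [val_cons, le_of_iff, prod_of] using hu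
  · rintro (⟨h, h'⟩ | ⟨e, he, q, hq, hx⟩)
    · calc of a * x = 1 * (of a * x) := (one_mul _).symm
        _ ≤ _ := mul_le_mul' (of_mono h) h'
    · calc of a * x ≤ of a * (e * q) := mul_le_mul_right hx _
        _ = (of a * e) * q := (mul_assoc ..).symm
        _ ≤ _ := mul_le_mul' (le_of_iff.2 (by simpa [prod_of] using he)) hq

theorem mul_of_le_mul_of_iff {a b : M} {x n : FPlus M} : x * of a ≤ n * of b ↔
    (1 ≤ b ∧ x * of a ≤ n) ∨ ∃ q ≤ n, ∃ e, prod M e * a ≤ b ∧ x ≤ q * e := by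
  constructor
  · intro h
    obtain ⟨w, rfl⟩ := exists_val x
    rw [← val_singleton a, ← val_append] at h
    obtain ⟨u, v, e, hu, hv⟩ := val_split _ _ _ h
    rcases List.eq_nil_or_concat v with rfl | ⟨t, a', rfl⟩
    · refine .inl ⟨by simpa [val_nil, le_of_iff] using hv, ?_⟩
      rw [← val_singleton a, ← val_append, e]
      simpa using hu
    · rw [List.concat_eq_append, ← List.append_assoc] at e
      obtain ⟨rfl, e'⟩ := List.append_inj' e rfl
      obtain rfl := by simpa using e'
      refine .inr ⟨val u, hu, val t, ?_, (val_append u t).le⟩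
      rw [List.concat_eq_append, val_append, val_singleton, le_of_iff] at hv
      simpa [prod_of] using hv
  · rintro (⟨h, h'⟩ | ⟨q, hq, e, he, hx⟩)
    · calc x * of a = (x * of a) * 1 := (mul_one _).symm
        _ ≤ _ := mul_le_mul' h' (of_mono h)
    · calc x * of a ≤ (q * e) * of a := mul_le_mul_left hx _
        _ = q * (e * of a) := mul_assoc ..
        _ ≤ _ := mul_le_mul' hq (le_of_iff.2 (by simpa [prod_of] using he))

theorem isFG_prod_mem {S : Set M} (hS : IsFG S) : IsFG {n : FPlus M | prod M n ∈ S} := by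
  obtain ⟨F, hF, h⟩ := hS
  refine ⟨of '' F, hF.image _, fun n => ?_⟩
  simp [h, le_of_iff]

theorem isFG_of_mul_le (h : ∀ a c : M, IsFG {b | a * b ≤ c}) (a : M) (n : FPlus M) :
    IsFG {x | of a * x ≤ n} := by
  obtain ⟨g, rfl⟩ := exists_val n
  induction g with
  | nil => simpa [val_nil, le_one_iff, prod_of] using isFG_prod_mem (h a 1)
  | cons b g ih =>
    simp only [val_cons, of_mul_le_of_mul_iff]
    refine .union ?_ (.mul (isFG_prod_mem (h a b)) (.Iic (val g)))
    by_cases hb : 1 ≤ b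
    · simp only [hb, true_and]; exact ih
    · simp only [hb, false_and]; exact IsFG.empty

theorem isFG_mul_of_le (h : ∀ a c : M, IsFG {b | b * a ≤ c}) (a : M) (n : FPlus M) :
    IsFG {x | x * of a ≤ n} := by
  obtain ⟨g, rfl⟩ := exists_val n
  induction g using List.reverseRecOn with
  | nil => simpa [val_nil, le_one_iff, prod_of] using isFG_prod_mem (h a 1)
  | append_singleton g b ih =>
    simp only [val_append, val_singleton, mul_of_le_mul_of_iff]
    refine .union ?_ (.mul (.Iic (val g)) (isFG_prod_mem (h a b)))
    by_cases hb : 1 ≤ b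
    · simp only [hb, true_and]; exact ih
    · simp only [hb, false_and]; exact IsFG.empty

/-- Integrality leaves only one alternative of `of_mul_le_of_mul_iff` in play, so the residual by a
letter is principal; residuals by words are iterated ones. -/
theorem exists_residual_left (hI : Integral M) (h : ∀ a c : M, ∃ d, ∀ b, a * b ≤ c ↔ b ≤ d)
    (m n : FPlus M) : ∃ d, ∀ x, m * x ≤ n ↔ x ≤ d := by
  have key : ∀ (a : M) (n : FPlus M), ∃ d, ∀ x, of a * x ≤ n ↔ x ≤ d := fun a n => by
    obtain ⟨g, rfl⟩ := exists_val n
    induction g with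
    | nil =>
      obtain ⟨d, hd⟩ := h a 1
      exact ⟨of d, fun x => by simp [val_nil, le_one_iff, prod_of, le_of_iff, hd]⟩
    | cons b g ih =>
      -- If `1 ≤ b`, then `b = 1` and the letter drops out. Otherwise the residual is `(a \ b) ∘ g`.
      by_cases hb : 1 ≤ b
      · rw [val_cons, show of b = 1 from congrArg of (le_antisymm (hI b) hb), one_mul]
        exact ih
      · obtain ⟨d, hd⟩ := h a b
        refine ⟨of d * val g, fun x => ?_⟩
        simp only [val_cons, of_mul_le_of_mul_iff, hb, false_and, false_or]
        constructor
        · rintro ⟨e, he, q, hq, hx⟩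
          exact hx.trans (mul_le_mul' (le_of_iff.2 ((hd _).1 he)) hq)
        · exact fun hx => ⟨of d, by rw [prod_of, hd], _, le_rfl, hx⟩
  obtain ⟨w, rfl⟩ := exists_val m
  induction w generalizing n with
  | nil => exact ⟨n, fun x => by simp [val_nil]⟩
  | cons a w ih =>
    obtain ⟨d, hd⟩ := key a n
    obtain ⟨d', hd'⟩ := ih d
    exact ⟨d', fun x => by rw [val_cons, mul_assoc, hd, hd']⟩

theorem exists_residual_right (hI : Integral M) (h : ∀ a c : M, ∃ d, ∀ b, b * a ≤ c ↔ b ≤ d)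
    (m n : FPlus M) : ∃ d, ∀ x, x * m ≤ n ↔ x ≤ d := by
  have key : ∀ (a : M) (n : FPlus M), ∃ d, ∀ x, x * of a ≤ n ↔ x ≤ d := fun a n => by
    obtain ⟨g, rfl⟩ := exists_val n
    induction g using List.reverseRecOn with
    | nil =>
      obtain ⟨d, hd⟩ := h a 1
      exact ⟨of d, fun x => by simp [val_nil, le_one_iff, prod_of, le_of_iff, hd]⟩
    | append_singleton g b ih =>
      rw [val_append, val_singleton]
      by_cases hb : 1 ≤ b
      · rw [show of b = 1 from congrArg of (le_antisymm (hI b) hb), mul_one]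
        exact ih
      · obtain ⟨d, hd⟩ := h a b
        refine ⟨val g * of d, fun x => ?_⟩
        simp only [mul_of_le_mul_of_iff, hb, false_and, false_or]
        constructor
        · rintro ⟨q, hq, e, he, hx⟩
          exact hx.trans (mul_le_mul' hq (le_of_iff.2 ((hd _).1 he)))
        · exact fun hx => ⟨_, le_rfl, of d, by rw [prod_of, hd], hx⟩
  obtain ⟨w, rfl⟩ := exists_val m
  induction w using List.reverseRecOn generalizing n with
  | nil => exact ⟨n, fun x => by simp [val_nil]⟩
  | append_singleton w a ih =>
    obtain ⟨d, hd⟩ := key a n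
    obtain ⟨d', hd'⟩ := ih d
    exact ⟨d', fun x => by rw [val_append, val_singleton, ← mul_assoc, hd, hd']⟩

end FPlus

end FPlusFacts

/-! ### Contextual refinement of words -/

section Refines

variable {M : Type u} {N : Type v} [Monoid N] [PartialOrder N]

/-- In every context, everything below `α` is below `β`. -/
def Refines (ℓ : M → N) (α β : List (M × Bool)) : Prop :=
  ∀ (γ δ : List (M × Bool)) (n : N), Below ℓ n (γ ++ α ++ δ) → Below ℓ n (γ ++ β ++ δ)

variable {ℓ : M → N}

namespace Refines

theorem trans {α β δ : List (M × Bool)} (h : Refines ℓ α β) (h' : Refines ℓ β δ) :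
    Refines ℓ α δ := fun γ γ' n k => h' γ γ' n (h γ γ' n k)

theorem context {α β : List (M × Bool)} (h : Refines ℓ α β) (ξ η : List (M × Bool)) :
    Refines ℓ (ξ ++ α ++ η) (ξ ++ β ++ η) := fun γ δ n k => by
  simpa using h (γ ++ ξ) (η ++ δ) n (by simpa using k)

variable [MulLeftMono N] [MulRightMono N]

theorem pos_mono {u v : List M} (h : wordVal ℓ u ≤ wordVal ℓ v) : Refines ℓ (pos u) (pos v) :=
  fun _ _ _ k => k.cut (.pos v h)

theorem insert_pos_neg (u : List M) : Refines ℓ [] (pos u ++ neg u) := fun _ _ _ k =>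
  Below.insert (by simpa using k) (.append_neg (.pos u (one_mul _).le))

theorem insert_neg_pos (u : List M) : Refines ℓ [] (neg u ++ pos u) := fun _ _ _ k =>
  Below.insert (by simpa using k) (.neg_append (.pos u (mul_one _).le))

theorem delete_pos_neg (hℓ : SplittingLetters ℓ) (u : List M) :
    Refines ℓ (pos u ++ neg u) [] := by
  induction u with
  | nil => exact fun _ _ _ k => k
  | cons a u ih =>
    have h := ih.context (pos [a]) [(a, false)]
    refine trans (by simpa [pos, neg] using h) fun γ δ n k => ?_
    simpa using Below.delete_pos_neg (α := γ) (β := δ) hℓ (by simpa [pos] using k)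

theorem delete_neg_pos (hℓ : SplittingLetters ℓ) (u : List M) :
    Refines ℓ (neg u ++ pos u) [] := by
  induction u with
  | nil => exact fun _ _ _ k => k
  | cons a u ih =>
    refine trans (fun γ δ n k => ?_) ih
    have k' : Below ℓ n ((γ ++ neg u) ++ (a, false) :: pos [a] ++ (pos u ++ δ)) := by
      simpa [pos, neg] using k
    simpa using Below.delete_neg_pos hℓ k'

end Refines

end Refines

/-! ### Completeness of derivations and the universal property -/

section FreePogroup

variable {M : Type u} [Monoid M] [PartialOrder M] [MulLeftMono M] [MulRightMono M]

/-- Each rule is a chain of insertions of inverse pairs, one monotonicity step on a positive block,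
and deletions. Only the deletions depend on integral closedness. -/
theorem Rule.refines (hM : IntegrallyClosed M) {ρ τ : List (M × Bool)} (h : Rule ρ τ) :
    Refines (FPlus.of (M := M)) ρ τ := by
  have hℓ := FPlus.splittingLetters hM
  have hv : ∀ w : List M, FPlus.val w = wordVal FPlus.of w := fun _ => rfl
  have ip := Refines.insert_pos_neg (ℓ := FPlus.of (M := M))
  have ii := Refines.insert_neg_pos (ℓ := FPlus.of (M := M))
  have dp := Refines.delete_pos_neg hℓ
  have di := Refines.delete_neg_pos hℓ
  cases h with
  | posMono u a h => exact .pos_mono (by simpa [hv] using h)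
  | negMono u a h =>
    -- The chain is `a⁻¹ ⊑ a⁻¹ u u⁻¹ ⊑ a⁻¹ a u⁻¹ ⊑ u⁻¹`.
    have h₁ := (ip u).context (neg [a]) []
    have h₂ := (Refines.pos_mono (ℓ := FPlus.of) (u := u) (v := [a])
      (by simpa [hv] using h)).context (neg [a]) (neg u)
    have h₃ := (di [a]).context [] (neg u)
    simp only [List.append_assoc, List.append_nil, List.nil_append] at h₁ h₂ h₃
    exact (h₁.trans h₂).trans h₃
  | contraction u v w x _ h =>
    have h₁ := (Refines.pos_mono (ℓ := FPlus.of) (u := v) (v := u ++ x ++ w)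
      (by simpa [hv, mul_assoc] using h)).context (neg u) (neg w)
    have h₂ := (di u).context [] (pos x ++ pos w ++ neg w)
    have h₃ := (dp w).context (pos x) []
    simp only [pos_append, List.append_assoc, List.append_nil, List.nil_append] at h₁ h₂ h₃ ⊢
    exact (h₁.trans h₂).trans h₃
  | expansion u v w x _ h =>
    have h₁ := (Refines.pos_mono (ℓ := FPlus.of) (v := v) (u := u ++ x ++ w)
      (by simpa [hv, mul_assoc] using h)).context (neg u) (neg w)
    have h₂ := (ii u).context [] (pos x ++ pos w ++ neg w)
    have h₃ := (ip w).context (pos x) []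
    simp only [pos_append, List.append_assoc, List.append_nil, List.nil_append] at h₁ h₂ h₃ ⊢
    exact (h₃.trans h₂).trans h₁
  | permutation₁ u v x y _ _ h =>
    have h₁ := (ii x).context [] (pos u ++ neg v)
    have h₂ := (Refines.pos_mono (ℓ := FPlus.of) (u := x ++ u) (v := y ++ v)
      (by simpa [hv] using h)).context (neg x) (neg v)
    have h₃ := (dp v).context (neg x ++ pos y) []
    simp only [pos_append, List.append_assoc, List.append_nil, List.nil_append] at h₁ h₂ h₃ ⊢
    exact (h₁.trans h₂).trans h₃
  | permutation₂ u v x y _ _ h =>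
    have h₁ := (ip y).context (neg u ++ pos v) []
    have h₂ := (Refines.pos_mono (ℓ := FPlus.of) (u := v ++ y) (v := u ++ x)
      (by simpa [hv] using h)).context (neg u) (neg y)
    have h₃ := (di u).context [] (pos x ++ neg y)
    simp only [pos_append, List.append_assoc, List.append_nil, List.nil_append] at h₁ h₂ h₃ ⊢
    exact (h₁.trans h₂).trans h₃

theorem Below.of_GLE (hM : IntegrallyClosed M) {n : FPlus M} {α β : List (M × Bool)}
    (h : GLE α β) (hn : Below FPlus.of n α) : Below FPlus.of n β := by
  induction h with
  | refl => exact hn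
  | tail _ h ih =>
    obtain ⟨α, β, h⟩ := h
    exact h.refines hM α β n ih

namespace FreePogroup

theorem exists_mk (g : FreePogroup M) : ∃ α, mk α = g := by
  obtain ⟨⟨α⟩⟩ := g
  exact ⟨α, rfl⟩

theorem mk_append (α β : List (M × Bool)) : mk (α ++ β) = mk α * mk β := rfl

theorem mk_neg_singleton (a : M) : mk [(a, false)] = (mk [(a, true)])⁻¹ := rfl

theorem toFreePogroup_val (w : List M) : toFreePogroup M (FPlus.val w) = mk (pos w) := by
  rcases eq_or_ne w [] with rfl | hw
  · exact map_one (toFreePogroup M)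
  · rw [FPlus.val_eq_mk ⟨w, hw⟩]
    rfl

theorem toFreePogroup_of (a : M) : toFreePogroup M (FPlus.of a) = mk [(a, true)] := rfl

theorem toFreePogroup_le_of_below {n : FPlus M} {α : List (M × Bool)}
    (h : Below FPlus.of n α) : toFreePogroup M n ≤ mk α := by
  have hmono : ∀ {m n : FPlus M}, m ≤ n → toFreePogroup M m ≤ toFreePogroup M n :=
    fun h => (toFreePogroup M).monotone' h
  induction h with
  | pos v h => exact (hmono h).trans_eq (toFreePogroup_val v)
  | @left n y z x a α β _ _ hx hn ihα ihβ =>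
    have h₁ := (hmono hx).trans ihβ
    rw [map_mul, toFreePogroup_of, ← le_inv_mul_iff_mul_le] at h₁
    have h₂ := hmono hn
    rw [map_mul] at h₂
    exact h₂.trans (mul_le_mul' ihα h₁)
  | @right n y z x a α β _ _ hx hn ihα ihβ =>
    have h₁ := (hmono hx).trans ihα
    rw [map_mul, toFreePogroup_of, ← le_mul_inv_iff_mul_le] at h₁
    have h₂ := hmono hn
    rw [map_mul] at h₂
    refine (h₂.trans (mul_le_mul' h₁ ihβ)).trans_eq ?_
    rw [mul_assoc]
    rfl

/-- For completeness, write `n` as a positive word: it is trivially below itself, and `Below` is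
preserved along the preorder. -/
theorem toFreePogroup_le_mk_iff (hM : IntegrallyClosed M) {n : FPlus M} {α : List (M × Bool)} :
    toFreePogroup M n ≤ mk α ↔ Below FPlus.of n α := by
  refine ⟨fun h => ?_, toFreePogroup_le_of_below⟩
  obtain ⟨w, rfl⟩ := FPlus.exists_val n
  rw [toFreePogroup_val] at h
  exact Below.of_GLE hM h (.pos w le_rfl)

theorem toFreePogroup_le_iff (hM : IntegrallyClosed M) {m n : FPlus M} :
    toFreePogroup M m ≤ toFreePogroup M n ↔ m ≤ n := by
  refine ⟨fun h => ?_, fun h => (toFreePogroup M).monotone' h⟩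
  obtain ⟨v, rfl⟩ := FPlus.exists_val n
  rw [toFreePogroup_val, toFreePogroup_le_mk_iff hM] at h
  exact h.le_wordVal

section Lift

variable {H : Type v} [Group H] [PartialOrder H]

/-- The value in a pogroup of a letter. -/
def evalLetter (f : FPlus M →*o H) (p : M × Bool) : H :=
  if p.2 then f (FPlus.of p.1) else (f (FPlus.of p.1))⁻¹

/-- The value in a pogroup of a word. -/
def eval (f : FPlus M →*o H) (α : List (M × Bool)) : H := (α.map (evalLetter f)).prod

theorem eval_append (f : FPlus M →*o H) (α β : List (M × Bool)) :
    eval f (α ++ β) = eval f α * eval f β := by simp [eval]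

theorem eval_pos (f : FPlus M →*o H) (u : List M) : eval f (pos u) = f (FPlus.val u) := by
  induction u with
  | nil => exact (map_one f).symm
  | cons a u ih =>
    rw [FPlus.val_cons, map_mul, ← ih]
    simp [eval, pos, evalLetter]

theorem eval_neg (f : FPlus M →*o H) (u : List M) : eval f (neg u) = (f (FPlus.val u))⁻¹ := by
  induction u with
  | nil => simp [eval, neg, FPlus.val_nil]
  | cons a u ih =>
    rw [FPlus.val_cons, map_mul, neg_cons, eval_append, ih, mul_inv_rev]
    simp [eval, evalLetter]

variable [MulLeftMono H] [MulRightMono H]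

theorem eval_rule (f : FPlus M →*o H) {ρ τ : List (M × Bool)} (h : Rule ρ τ) :
    eval f ρ ≤ eval f τ := by
  have hf : ∀ {m n : FPlus M}, m ≤ n → f m ≤ f n := fun h => f.monotone' h
  cases h with
  | posMono u a h =>
    rw [eval_pos, eval_pos, FPlus.val_singleton]
    exact hf h
  | negMono u a h =>
    rw [eval_neg, eval_neg, FPlus.val_singleton]
    exact inv_le_inv_iff.2 (hf h)
  | contraction u v w x _ h =>
    have := hf h
    simp only [map_mul] at this
    rw [eval_append, eval_append, eval_neg, eval_pos, eval_neg, eval_pos, mul_inv_le_iff_le_mul,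
      inv_mul_le_iff_le_mul, ← mul_assoc]
    exact this
  | expansion u v w x _ h =>
    have := hf h
    simp only [map_mul] at this
    rw [eval_append, eval_append, eval_neg, eval_pos, eval_neg, eval_pos, le_mul_inv_iff_mul_le,
      le_inv_mul_iff_mul_le, ← mul_assoc]
    exact this
  | permutation₁ u v x y _ _ h =>
    have := hf h
    simp only [map_mul] at this
    rw [eval_append, eval_append, eval_neg, eval_pos, eval_neg, eval_pos, mul_inv_le_iff_le_mul,
      mul_assoc, le_inv_mul_iff_mul_le]
    exact this
  | permutation₂ u v x y _ _ h =>
    have := hf h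
    simp only [map_mul] at this
    rw [eval_append, eval_append, eval_neg, eval_pos, eval_neg, eval_pos, le_mul_inv_iff_mul_le,
      mul_assoc, inv_mul_le_iff_le_mul]
    exact this

theorem eval_mono (f : FPlus M →*o H) {α β : List (M × Bool)} (h : GLE α β) :
    eval f α ≤ eval f β := by
  induction h with
  | refl => exact le_rfl
  | tail _ h ih =>
    obtain ⟨α, β, h⟩ := h
    refine ih.trans ?_
    simp only [eval_append]
    exact mul_le_mul' (mul_le_mul' le_rfl (eval_rule f h)) le_rfl

/-- The extension of a homomorphism from `FPlus M` to a pogroup. -/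
def lift (f : FPlus M →*o H) : FreePogroup M →*o H where
  toFun := Quotient.lift (fun α => eval f α.letters) fun _ _ h =>
    le_antisymm (eval_mono f h.1) (eval_mono f h.2)
  map_one' := rfl
  map_mul' := by
    rintro ⟨x⟩ ⟨y⟩
    exact eval_append f _ _
  monotone' := by
    rintro ⟨x⟩ ⟨y⟩ h
    exact eval_mono f h

theorem lift_mk (f : FPlus M →*o H) (α : List (M × Bool)) : lift f (mk α) = eval f α := rfl

theorem existsUnique_lift (f : FPlus M →*o H) :
    ∃! g : FreePogroup M →*o H, ∀ w, g (toFreePogroup M w) = f w := by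
  refine ⟨lift f, fun n => ?_, fun g hg => ?_⟩
  · obtain ⟨w, rfl⟩ := FPlus.exists_val n
    rw [toFreePogroup_val, lift_mk, eval_pos]
  · ext x
    obtain ⟨α, rfl⟩ := exists_mk x
    rw [lift_mk]
    induction α with
    | nil => exact map_one g
    | cons p α ih =>
      have hp : g (mk [p]) = evalLetter f p := by
        rcases p with ⟨a, _ | _⟩
        · rw [mk_neg_singleton, map_inv, ← toFreePogroup_of, hg]
          rfl
        · exact hg (FPlus.of a)
      rw [show p :: α = [p] ++ α from rfl, mk_append, map_mul, ih, hp, eval_append]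
      simp [eval]

end Lift

end FreePogroup

end FreePogroup

/-! ### Residuation in terms of sets of solutions -/

section FGDownset

variable {P : Type u} [PartialOrder P]

theorem FGDownset.le_iff {X Y : FGDownset P} : X ≤ Y ↔ ∀ x ∈ X, x ∈ Y := Iff.rfl

theorem FGDownset.ext {X Y : FGDownset P} (h : ∀ x, x ∈ X ↔ x ∈ Y) : X = Y :=
  le_antisymm (fun x => (h x).1) fun x => (h x).2

theorem FGDownset.mem_of_le {X : FGDownset P} {a b : P} (hb : b ∈ X) (h : a ≤ b) : a ∈ X :=
  X.1.lower h hb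

theorem mem_principal {a b : P} : b ∈ principal a ↔ b ≤ a :=
  (mem_lowerClosure (s := {a})).trans (by simp)

theorem principal_le_iff {a : P} {X : FGDownset P} : principal a ≤ X ↔ a ∈ X :=
  ⟨fun h => h (mem_principal.2 le_rfl), fun h _ hb => X.mem_of_le h (mem_principal.1 hb)⟩

theorem mem_sharp {f : P →o FGDownset P} {X : FGDownset P} {y : P} :
    y ∈ sharp f X ↔ ∃ x ∈ X, y ∈ f x := by
  refine (LowerSet.mem_iSup₂_iff (f := fun x (_ : x ∈ X.1) => (f x).1)).trans ?_
  simp only [exists_prop]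
  rfl

theorem FGDownset.mem_mul {M : Type u} [Monoid M] [PartialOrder M] [MulLeftMono M]
    [MulRightMono M] {X Y : FGDownset M} {z : M} :
    z ∈ X * Y ↔ ∃ x ∈ X, ∃ y ∈ Y, z ≤ x * y := by
  refine (mem_lowerClosure (s := {z | ∃ x ∈ X, ∃ y ∈ Y, x * y = z})).trans ?_
  constructor
  · rintro ⟨_, ⟨x, hx, y, hy, rfl⟩, h⟩
    exact ⟨x, hx, y, hy, h⟩
  · rintro ⟨x, hx, y, hy, h⟩
    exact ⟨_, ⟨x, hx, y, hy, rfl⟩, h⟩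

/-- A non-empty finitely generated downset, given as a set. -/
def IsFG.toFGDownset {S : Set P} (hS : IsFG S) (hne : S.Nonempty) : FGDownset P :=
  ⟨⟨S, fun a b h ha => by
    obtain ⟨F, -, hF⟩ := hS
    obtain ⟨f, hf, haf⟩ := (hF a).1 ha
    exact (hF b).2 ⟨f, hf, h.trans haf⟩⟩, by
    obtain ⟨F, hfin, hF⟩ := hS
    refine ⟨F, hfin, ?_, ?_⟩
    · obtain ⟨a, ha⟩ := hne
      obtain ⟨f, hf, -⟩ := (hF a).1 ha
      exact ⟨f, hf⟩
    · ext a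
      exact (hF a).trans mem_lowerClosure.symm⟩

theorem FGDownset.isFG (X : FGDownset P) : IsFG {x | x ∈ X} := by
  obtain ⟨X, F, hF, -, rfl⟩ := X
  exact ⟨F, hF, fun x => mem_lowerClosure⟩

theorem FGDownset.nonempty (X : FGDownset P) : {x | x ∈ X}.Nonempty := by
  obtain ⟨X, F, hF, ⟨f, hf⟩, rfl⟩ := X
  exact ⟨f, subset_lowerClosure hf⟩

theorem ideallyResiduated_iff {M : Type u} [Monoid M] [PartialOrder M] :
    IdeallyResiduated M ↔ ∀ a c : M, (IsFG {b | a * b ≤ c} ∧ {b | a * b ≤ c}.Nonempty) ∧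
      IsFG {b | b * a ≤ c} ∧ {b | b * a ≤ c}.Nonempty := by
  constructor
  · rintro ⟨ld, rd, h⟩ a c
    have h₁ : {b | a * b ≤ c} = {b | b ∈ ld a c} :=
      Set.ext fun b => (h a b c).1.symm.trans principal_le_iff
    have h₂ : {b | b * a ≤ c} = {b | b ∈ rd c a} :=
      Set.ext fun b => (h b a c).2.trans principal_le_iff
    rw [h₁, h₂]
    exact ⟨⟨FGDownset.isFG _, FGDownset.nonempty _⟩, FGDownset.isFG _, FGDownset.nonempty _⟩
  · intro h
    exact ⟨fun a c => (h a c).1.1.toFGDownset (h a c).1.2,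
      fun c a => (h a c).2.1.toFGDownset (h a c).2.2,
      fun a b c => ⟨principal_le_iff,
        (principal_le_iff (X := (h b c).2.1.toFGDownset (h b c).2.2)).symm⟩⟩

theorem residuated_iff {M : Type u} [Monoid M] [PartialOrder M] :
    Residuated M ↔ ∀ a c : M, (∃ d, ∀ b, a * b ≤ c ↔ b ≤ d) ∧ ∃ d, ∀ b, b * a ≤ c ↔ b ≤ d := by
  constructor
  · rintro ⟨ld, rd, h⟩ a c
    exact ⟨⟨ld a c, fun b => (h a b c).1.symm⟩, rd c a, fun b => (h b a c).2⟩
  · intro h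
    choose ld hld using fun a c => (h a c).1
    choose rd hrd using fun a c => (h a c).2
    exact ⟨ld, fun c a => rd a c, fun a b c => ⟨(hld a c b).symm, hrd b c a⟩⟩

theorem Residuated.ideallyResiduated {M : Type u} [Monoid M] [PartialOrder M]
    (h : Residuated M) : IdeallyResiduated M := by
  rw [ideallyResiduated_iff]
  intro a c
  obtain ⟨⟨d, hd⟩, d', hd'⟩ := residuated_iff.1 h a c
  rw [show {b | a * b ≤ c} = Set.Iic d from Set.ext hd,
    show {b | b * a ≤ c} = Set.Iic d' from Set.ext hd']
  exact ⟨⟨.Iic d, d, le_rfl⟩, .Iic d', d', le_rfl⟩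

theorem Integral.integrallyClosed {M : Type u} [Monoid M] [PartialOrder M] (h : Integral M) :
    IntegrallyClosed M := fun _ x => ⟨fun _ => h x, fun _ => h x⟩

end FGDownset

/-! ### Nuclear images as adjoint retracts -/

section NuclearRetraction

variable {N M : Type u} [Monoid N] [PartialOrder N] [Monoid M] [PartialOrder M]

/-- A homomorphism `r : N → M` with a right adjoint `s` that is also a right inverse of `r`. -/
structure NuclearRetraction (r : N →*o M) (s : M → N) : Prop where
  le_iff : ∀ n a, n ≤ s a ↔ r n ≤ a
  right_inv : ∀ a, r (s a) = a

namespace NuclearRetraction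

variable {r : N →*o M} {s : M → N}

theorem map_mul_le_iff (h : NuclearRetraction r s) (a b c : M) : s a * s b ≤ s c ↔ a * b ≤ c := by
  rw [h.le_iff, map_mul, h.right_inv, h.right_inv]

theorem integral (h : NuclearRetraction r s) (hN : Integral N) : Integral M := fun x => by
  simpa [h.right_inv] using r.monotone' (hN (s x))

theorem integrallyClosed (h : NuclearRetraction r s) (hN : IntegrallyClosed N) :
    IntegrallyClosed M := fun a x => by
  constructor
  · intro k
    simpa [h.right_inv] using r.monotone' ((hN (s a) (s x)).1 ((h.map_mul_le_iff _ _ _).2 k))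
  · intro k
    simpa [h.right_inv] using r.monotone' ((hN (s a) (s x)).2 ((h.map_mul_le_iff _ _ _).2 k))

/-- Since `S` is stable under the nucleus `s ∘ r`, the images under `r` of its generators generate
the preimage. -/
theorem isFG_preimage (h : NuclearRetraction r s) {S : Set N} (hS : IsFG S)
    (hr : ∀ n ∈ S, s (r n) ∈ S) : IsFG {a | s a ∈ S} := by
  obtain ⟨F, hF, hS⟩ := hS
  refine ⟨r '' F, hF.image _, fun a => ?_⟩
  rw [Set.mem_ofPred_eq, hS]
  simp only [Set.exists_mem_image]
  constructor
  · rintro ⟨f, hf, k⟩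
    exact ⟨f, hf, by simpa [h.right_inv] using r.monotone' k⟩
  · rintro ⟨f, hf, k⟩
    obtain ⟨g, hg, k'⟩ := (hS _).1 (hr f ((hS f).2 ⟨f, hf, le_rfl⟩))
    refine ⟨g, hg, le_trans ?_ k'⟩
    rwa [h.le_iff, h.right_inv]

theorem ideallyResiduated (h : NuclearRetraction r s) (hN : IdeallyResiduated N) :
    IdeallyResiduated M := by
  rw [ideallyResiduated_iff] at hN ⊢
  intro a c
  have key₁ : ∀ n ∈ {b | s a * b ≤ s c}, s (r n) ∈ {b | s a * b ≤ s c} := fun n hn => by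
    rw [Set.mem_ofPred_eq, h.le_iff] at hn
    rw [Set.mem_ofPred_eq, h.le_iff]
    simpa [h.right_inv] using hn
  have key₂ : ∀ n ∈ {b | b * s a ≤ s c}, s (r n) ∈ {b | b * s a ≤ s c} := fun n hn => by
    rw [Set.mem_ofPred_eq, h.le_iff] at hn
    rw [Set.mem_ofPred_eq, h.le_iff]
    simpa [h.right_inv] using hn
  have e₁ : {b | a * b ≤ c} = {b | s b ∈ {b | s a * b ≤ s c}} :=
    Set.ext fun b => (h.map_mul_le_iff a b c).symm
  have e₂ : {b | b * a ≤ c} = {b | s b ∈ {b | b * s a ≤ s c}} :=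
    Set.ext fun b => (h.map_mul_le_iff b a c).symm
  obtain ⟨⟨h₁, n₁, k₁⟩, h₂, n₂, k₂⟩ := hN (s a) (s c)
  rw [e₁, e₂]
  exact ⟨⟨h.isFG_preimage h₁ key₁, r n₁, key₁ n₁ k₁⟩, h.isFG_preimage h₂ key₂, r n₂, key₂ n₂ k₂⟩

theorem residuated (h : NuclearRetraction r s) (hN : Residuated N) : Residuated M := by
  rw [residuated_iff] at hN ⊢
  intro a c
  obtain ⟨⟨d, hd⟩, d', hd'⟩ := hN (s a) (s c)
  have key : ∀ d b, s b ≤ d → b ≤ r d := fun d b k => by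
    simpa [h.right_inv] using r.monotone' k
  have k₁ : a * r d ≤ c := by
    simpa [h.right_inv] using (h.le_iff _ _).1 ((hd d).2 le_rfl)
  have k₂ : r d' * a ≤ c := by
    simpa [h.right_inv] using (h.le_iff _ _).1 ((hd' d').2 le_rfl)
  refine ⟨⟨r d, fun b => ⟨fun k => ?_, fun k => ?_⟩⟩, r d', fun b => ⟨fun k => ?_, fun k => ?_⟩⟩
  · exact key _ _ ((hd _).1 ((h.map_mul_le_iff a b c).2 k))
  · rw [← h.map_mul_le_iff, hd]
    -- The residual `d` is closed: `a * r d ≤ c` gives `s (r d) ≤ d`.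
    refine le_trans ?_ ((hd (s (r d))).1 ?_)
    · rwa [h.le_iff, h.right_inv]
    · rwa [h.map_mul_le_iff]
  · exact key _ _ ((hd' _).1 ((h.map_mul_le_iff b a c).2 k))
  · rw [← h.map_mul_le_iff, hd']
    refine le_trans ?_ ((hd' (s (r d'))).1 ?_)
    · rwa [h.le_iff, h.right_inv]
    · rwa [h.map_mul_le_iff]

/-- The nucleus `s ∘ r`. -/
def nucleus (h : NuclearRetraction r s) : PoNucleus N where
  toFun n := s (r n)
  monotone' a b k := (h.le_iff _ _).2 (by rw [h.right_inv]; exact r.monotone' k)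
  le_closure' a := (h.le_iff _ _).2 le_rfl
  idempotent' a := by rw [h.right_inv]
  mul_le a b := by
    rw [h.map_mul_le_iff, map_mul]

variable [MulLeftMono N] [MulRightMono N]

/-- A nuclear retract is isomorphic to the nuclear image. -/
def isoImage (h : NuclearRetraction r s) : M ≃*o h.nucleus.Image where
  toFun a := ⟨s a, congrArg s (h.right_inv a)⟩
  invFun x := r x.1
  left_inv := h.right_inv
  right_inv x := Subtype.ext x.2
  map_mul' a b := Subtype.ext <| by
    change s (a * b) = s (r (s a * s b))
    rw [map_mul, h.right_inv, h.right_inv]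
  map_le_map_iff' {a b} := by
    change s a ≤ s b ↔ a ≤ b
    rw [h.le_iff, h.right_inv]

end NuclearRetraction

/-- A nuclear image is a nuclear retract. -/
theorem PoNucleus.exists_nuclearRetraction [MulLeftMono N] [MulRightMono N] (γ : PoNucleus N)
    (f : M ≃*o γ.Image) : ∃ (r : N →*o M) (s : M → N), NuclearRetraction r s := by
  let p : N →*o γ.Image :=
    { toFun := fun n => ⟨γ.toFun n, γ.idem n⟩
      map_one' := rfl
      map_mul' := fun a b => Subtype.ext <| by
        change γ.toFun (a * b) = γ.toFun (γ.toFun a * γ.toFun b)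
        rw [γ.map_mul_left, γ.map_mul_right]
      monotone' := fun _ _ h => γ.mono h }
  have hp : ∀ (n : N) (x : γ.Image), n ≤ x.1 ↔ p n ≤ x := fun n x =>
    ⟨fun h => (γ.mono h).trans_eq x.2, fun h => (γ.le n).trans h⟩
  let r : N →*o M :=
    { toFun := fun n => f.symm (p n)
      map_one' := by rw [map_one, map_one]
      map_mul' := fun a b => by rw [map_mul, map_mul]
      monotone' := fun _ _ h => (map_le_map_iff f.symm).2 (p.monotone' h) }
  refine ⟨r, fun a => (f a).1, fun n a => ?_, fun a => ?_⟩
  · rw [hp]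
    change _ ↔ f.symm (p n) ≤ a
    rw [← map_le_map_iff f, OrderMonoidIso.apply_symm_apply]
  · change f.symm (p (f a).1) = a
    have : p (f a).1 = f a := Subtype.ext (f a).2
    rw [this, OrderMonoidIso.symm_apply_apply]

end NuclearRetraction

/-! ### Ideal conuclear images and their construction -/

namespace IdealConucleus

section Image

variable {M : Type u} [Monoid M] [PartialOrder M] [MulLeftMono M] [MulRightMono M]
  (σ : IdealConucleus M)

theorem mem_image {a : M} : a ∈ σ.image ↔ a ∈ σ.toFun a := by
  change principal a = σ.toFun a ↔ _
  rw [← principal_le_iff]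
  exact ⟨fun h => h.le, fun h => le_antisymm h (σ.apply_le a)⟩

theorem le_of_mem {a b : M} (h : b ∈ σ.toFun a) : b ≤ a := mem_principal.1 (σ.apply_le a h)

/-- An open element lies in `σ a` iff it is below `a`. -/
theorem mem_toFun_iff {a b : M} (hb : b ∈ σ.image) : b ∈ σ.toFun a ↔ b ≤ a :=
  ⟨σ.le_of_mem, fun h => σ.monotone' h ((σ.mem_image).1 hb)⟩

/-- The downset `σ a` is generated by open elements. -/
theorem exists_open_ge {a b : M} (h : b ∈ σ.toFun a) :
    ∃ n ∈ σ.image, b ≤ n ∧ n ∈ σ.toFun a := by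
  obtain ⟨F, hF, hS⟩ := (σ.toFun a).isFG
  have hFσ : ∀ f ∈ F, f ∈ σ.toFun a := fun f hf => (hS f).2 ⟨f, hf, le_rfl⟩
  obtain ⟨f, hf, hbf⟩ := (hS b).1 h
  obtain ⟨m, hfm, hm⟩ := hF.exists_le_maximal hf
  refine ⟨m, ?_, hbf.trans hfm, hFσ m hm.1⟩
  have hm' : m ∈ sharp σ.toOrderHom (σ.toFun a) := by
    rw [σ.sharp_apply]
    exact hFσ m hm.1
  obtain ⟨x, hx, hmx⟩ := mem_sharp.1 hm'
  obtain ⟨f', hf', hxf'⟩ := (hS x).1 hx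
  -- Here `m ≤ x ≤ f'`, because `m ∈ σ x`; maximality of `m` among the generators forces `f' ≤ m`,
  -- hence `x ≤ m` and `m ∈ σ m`.
  have hxm : x ≤ m := hxf'.trans (hm.2 hf' ((σ.le_of_mem hmx).trans hxf'))
  exact (σ.mem_image).2 (σ.monotone' hxm hmx)

theorem isFG_open_le (a : M) : IsFG {n : σ.image | (n : M) ≤ a} := by
  obtain ⟨F, hF, hS⟩ := (σ.toFun a).isFG
  choose! g hg hle hga using fun f (hf : f ∈ F) =>
    σ.exists_open_ge ((hS f).2 ⟨f, hf, le_rfl⟩ : f ∈ σ.toFun a)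
  refine ⟨{n | (n : M) ∈ g '' F}, (hF.image g).preimage Subtype.val_injective.injOn, fun n => ?_⟩
  rw [Set.mem_ofPred_eq, ← σ.mem_toFun_iff n.2]
  constructor
  · intro h
    obtain ⟨f, hf, hn⟩ := (hS n).1 h
    exact ⟨⟨g f, hg f hf⟩, ⟨f, hf, rfl⟩, hn.trans (hle f hf)⟩
  · rintro ⟨_, ⟨f, hf, e⟩, hn⟩
    refine FGDownset.mem_of_le (hga f hf) ?_
    rw [e]
    exact hn

theorem nonempty_open_le (a : M) : {n : σ.image | (n : M) ≤ a}.Nonempty := by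
  obtain ⟨b, hb⟩ := (σ.toFun a).nonempty
  obtain ⟨n, hn, -, h⟩ := σ.exists_open_ge hb
  exact ⟨⟨n, hn⟩, σ.le_of_mem h⟩

theorem exists_greatest_open_le {a : M} (h : IsPrincipal (σ.toFun a)) :
    ∃ d : σ.image, ∀ n : σ.image, (n : M) ≤ a ↔ n ≤ d := by
  obtain ⟨d, hd⟩ := h
  obtain ⟨n, hn, hdn, k⟩ := σ.exists_open_ge (show d ∈ σ.toFun a by
    rw [hd]; exact mem_principal.2 le_rfl)
  refine ⟨⟨n, hn⟩, fun m => ⟨fun hm => ?_, fun hm => ?_⟩⟩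
  · rw [← σ.mem_toFun_iff m.2, hd, mem_principal] at hm
    exact hm.trans hdn
  · exact le_trans (show (m : M) ≤ n from hm) (σ.le_of_mem k)

theorem integral_image (h : σ.Negative) : Integral σ.image := fun x =>
  show (x : M) ≤ 1 from
    mem_principal.1 (FGDownset.le_iff.1 (h (x : M)) x ((σ.mem_image).1 x.2))

end Image

section Group

variable {G : Type u} [Group G] [PartialOrder G] [MulLeftMono G] [MulRightMono G]
  (σ : IdealConucleus G)

theorem integrallyClosed_image : IntegrallyClosed σ.image := fun a _ =>
  ⟨fun h => (mul_le_iff_le_one_right' (a : G)).1 h,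
    fun h => (mul_le_iff_le_one_left' (b := (a : G))).1 h⟩

theorem ideallyResiduated_image : IdeallyResiduated σ.image := by
  rw [ideallyResiduated_iff]
  intro a c
  have e₁ : {b : σ.image | a * b ≤ c} = {b : σ.image | (b : G) ≤ (a : G)⁻¹ * c} :=
    Set.ext fun b => le_inv_mul_iff_mul_le.symm
  have e₂ : {b : σ.image | b * a ≤ c} = {b : σ.image | (b : G) ≤ c * (a : G)⁻¹} :=
    Set.ext fun b => le_mul_inv_iff_mul_le.symm
  rw [e₁, e₂]
  exact ⟨⟨σ.isFG_open_le _, σ.nonempty_open_le _⟩, σ.isFG_open_le _, σ.nonempty_open_le _⟩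

theorem residuated_image (h : σ.PrincipalOnQuotients) : Residuated σ.image := by
  rw [residuated_iff]
  intro a c
  obtain ⟨d, hd⟩ := σ.exists_greatest_open_le (h a a.2 c c.2).1
  obtain ⟨d', hd'⟩ := σ.exists_greatest_open_le (h c c.2 a a.2).2
  exact ⟨⟨d, fun b => le_inv_mul_iff_mul_le.symm.trans (hd b)⟩,
    d', fun b => le_mul_inv_iff_mul_le.symm.trans (hd' b)⟩

end Group

section OfEmbedding

variable {N G : Type u} [Monoid N] [PartialOrder N] [Monoid G] [PartialOrder G]

theorem isFG_below_image {ι : N →*o G} {g : G} (hfg : IsFG {n | ι n ≤ g}) :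
    IsFG {h | ∃ n, h ≤ ι n ∧ ι n ≤ g} := by
  obtain ⟨F, hF, hS⟩ := hfg
  refine ⟨ι '' F, hF.image _, fun h => ?_⟩
  simp only [Set.exists_mem_image]
  constructor
  · rintro ⟨n, hn, hng⟩
    obtain ⟨f, hf, hnf⟩ := (hS n).1 hng
    exact ⟨f, hf, hn.trans (ι.monotone' hnf)⟩
  · rintro ⟨f, hf, hn⟩
    exact ⟨f, hn, (hS f).2 ⟨f, hf, le_rfl⟩⟩

variable [MulLeftMono G] [MulRightMono G]

/-- The ideal conucleus whose open elements are the elements in the range of `ι`. -/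
def ofHom (ι : N →*o G) (hfg : ∀ g, IsFG {n | ι n ≤ g}) (hne : ∀ g, ∃ n, ι n ≤ g) :
    IdealConucleus G where
  -- The value at `g` is the downset generated by the elements of the range of `ι` below `g`.
  toFun g := (isFG_below_image (hfg g)).toFGDownset (by
    obtain ⟨n, hn⟩ := hne g
    exact ⟨ι n, n, le_rfl, hn⟩)
  monotone' g g' h := FGDownset.le_iff.2 fun x ⟨n, hx, hn⟩ => ⟨n, hx, hn.trans h⟩
  sharp_apply g := FGDownset.ext fun x => by
    rw [mem_sharp]
    constructor
    · rintro ⟨y, ⟨n, hy, hn⟩, m, hx, hm⟩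
      exact ⟨m, hx, hm.trans (hy.trans hn)⟩
    · rintro ⟨n, hx, hn⟩
      exact ⟨ι n, ⟨n, le_rfl, hn⟩, n, hx, le_rfl⟩
  apply_le g := FGDownset.le_iff.2 fun x ⟨n, hx, hn⟩ => mem_principal.2 (hx.trans hn)
  mul_le g g' := FGDownset.le_iff.2 fun x hx => by
    obtain ⟨y, ⟨n, hy, hn⟩, z, ⟨m, hz, hm⟩, hx⟩ := FGDownset.mem_mul.1 hx
    exact ⟨n * m, by rw [map_mul]; exact hx.trans (mul_le_mul' hy hz),
      by rw [map_mul]; exact mul_le_mul' hn hm⟩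
  apply_one := FGDownset.ext fun x => by
    rw [mem_principal]
    constructor
    · rintro ⟨n, hx, hn⟩
      exact hx.trans hn
    · intro hx
      exact ⟨1, by rwa [map_one], (map_one ι).le⟩

variable {ι : N →*o G} {hfg : ∀ g, IsFG {n | ι n ≤ g}} {hne : ∀ g, ∃ n, ι n ≤ g}

theorem mem_ofHom {g h : G} : h ∈ (ofHom ι hfg hne).toFun g ↔ ∃ n, h ≤ ι n ∧ ι n ≤ g := Iff.rfl

theorem mem_image_ofHom {g : G} : g ∈ (ofHom ι hfg hne).image ↔ ∃ n, ι n = g := by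
  rw [mem_image, mem_ofHom]
  constructor
  · rintro ⟨n, h, h'⟩
    exact ⟨n, le_antisymm h' h⟩
  · rintro ⟨n, rfl⟩
    exact ⟨n, le_rfl, le_rfl⟩

theorem isPrincipal_ofHom {g : G} {d : N} (h : ∀ n, ι n ≤ g ↔ n ≤ d) :
    IsPrincipal ((ofHom ι hfg hne).toFun g) := by
  refine ⟨ι d, FGDownset.ext fun x => ?_⟩
  rw [mem_ofHom, mem_principal]
  constructor
  · rintro ⟨n, hx, hn⟩
    exact hx.trans (ι.monotone' ((h n).1 hn))
  · intro hx
    exact ⟨d, hx, (h d).2 le_rfl⟩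

theorem negative_ofHom (hN : Integral N) : (ofHom ι hfg hne).Negative := fun _ =>
  FGDownset.le_iff.2 fun _ ⟨n, hx, _⟩ => mem_principal.2 <|
    hx.trans ((ι.monotone' (hN n)).trans_eq (map_one ι))

theorem exists_iso_image_ofHom (hι : ∀ m n, ι m ≤ ι n → m ≤ n) :
    ∃ e : N ≃*o (ofHom ι hfg hne).image, ∀ n, (e n : G) = ι n := by
  let f : N →* (ofHom ι hfg hne).image :=
    (ι : N →* G).codRestrict _ fun n => mem_image_ofHom.2 ⟨n, rfl⟩
  have hf : Function.Bijective f := by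
    constructor
    · intro m n h
      have h' : ι m = ι n := congrArg Subtype.val h
      exact le_antisymm (hι _ _ h'.le) (hι _ _ h'.ge)
    · rintro ⟨g, hg⟩
      obtain ⟨n, rfl⟩ := mem_image_ofHom.1 hg
      exact ⟨n, rfl⟩
  exact ⟨⟨MulEquiv.ofBijective f hf, fun {m n} => ⟨hι m n, fun h => ι.monotone' h⟩⟩,
    fun _ => rfl⟩

end OfEmbedding

end IdealConucleus

variable {M : Type u} [Monoid M] [PartialOrder M] [MulLeftMono M] [MulRightMono M]

/-! ### The conucleus on the free pogroup -/

namespace FreePogroup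

theorem isFG_toFreePogroup_le (hM : IntegrallyClosed M) (hR : IdeallyResiduated M)
    (g : FreePogroup M) : IsFG {n | toFreePogroup M n ≤ g} := by
  obtain ⟨α, rfl⟩ := exists_mk g
  have h := ideallyResiduated_iff.1 hR
  simp only [toFreePogroup_le_mk_iff hM]
  exact Below.isFG (FPlus.isFG_of_mul_le fun a c => (h a c).1.1)
    (FPlus.isFG_mul_of_le fun a c => (h a c).2.1) α

theorem exists_toFreePogroup_le (hR : IdeallyResiduated M) (g : FreePogroup M) :
    ∃ n, toFreePogroup M n ≤ g := by
  obtain ⟨α, rfl⟩ := exists_mk g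
  have h : ∀ a : M, ∃ x, FPlus.of a * x ≤ 1 := fun a => by
    obtain ⟨b, hb⟩ := (ideallyResiduated_iff.1 hR a 1).1.2
    exact ⟨FPlus.of b, by simpa [FPlus.le_one_iff, FPlus.prod_of] using hb⟩
  obtain ⟨n, hn⟩ := Below.exists_below h α
  exact ⟨n, toFreePogroup_le_of_below hn⟩

/-- The ideal conucleus on the free pogroup with image `FPlus M`. -/
def conucleus (hM : IntegrallyClosed M) (hR : IdeallyResiduated M) :
    IdealConucleus (FreePogroup M) :=
  .ofHom (toFreePogroup M) (isFG_toFreePogroup_le hM hR) (exists_toFreePogroup_le hR)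

theorem exists_iso_image_conucleus (hM : IntegrallyClosed M) (hR : IdeallyResiduated M) :
    ∃ e : FPlus M ≃*o (conucleus hM hR).image, ∀ w, (e w : FreePogroup M) = toFreePogroup M w :=
  IdealConucleus.exists_iso_image_ofHom fun _ _ => (toFreePogroup_le_iff hM).1

theorem exists_nucleus (hM : IntegrallyClosed M) (hR : IdeallyResiduated M) :
    ∃ γ : PoNucleus (conucleus hM hR).image, Nonempty (M ≃*o γ.Image) := by
  obtain ⟨e, -⟩ := exists_iso_image_conucleus hM hR
  let r : (conucleus hM hR).image →*o M :=
    { toFun := fun x => FPlus.prod M (e.symm x)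
      map_one' := by rw [map_one, map_one]
      map_mul' := fun a b => by rw [map_mul, map_mul]
      monotone' := fun _ _ h => (FPlus.prod M).monotone' ((map_le_map_iff e.symm).2 h) }
  -- The adjunction between `FPlus.prod` and `FPlus.of`, transported along the isomorphism `e`.
  have h : NuclearRetraction r fun a => e (FPlus.of a) :=
    { le_iff := fun n a => by
        change _ ↔ FPlus.prod M (e.symm n) ≤ a
        rw [← FPlus.le_of_iff, ← map_le_map_iff e, OrderMonoidIso.apply_symm_apply]
      right_inv := fun a => by
        change FPlus.prod M (e.symm (e (FPlus.of a))) = a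
        rw [OrderMonoidIso.symm_apply_apply, FPlus.prod_of] }
  exact ⟨h.nucleus, ⟨h.isoImage⟩⟩

theorem negative_conucleus (hM : IntegrallyClosed M) (hR : IdeallyResiduated M)
    (hI : Integral M) : (conucleus hM hR).Negative :=
  IdealConucleus.negative_ofHom fun _ => FPlus.le_one_iff.2 (hI _)

theorem principalOnQuotients_conucleus (hM : IntegrallyClosed M) (hR : IdeallyResiduated M)
    (hI : Integral M) (hRes : Residuated M) : (conucleus hM hR).PrincipalOnQuotients := by
  intro x hx y hy
  obtain ⟨m, rfl⟩ := IdealConucleus.mem_image_ofHom.1 hx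
  obtain ⟨k, rfl⟩ := IdealConucleus.mem_image_ofHom.1 hy
  have h := residuated_iff.1 hRes
  constructor
  · obtain ⟨d, hd⟩ := FPlus.exists_residual_left hI (fun a c => (h a c).1) m k
    refine IdealConucleus.isPrincipal_ofHom (d := d) fun n => ?_
    rw [le_inv_mul_iff_mul_le, ← map_mul, toFreePogroup_le_iff hM, hd]
  · obtain ⟨d, hd⟩ := FPlus.exists_residual_right hI (fun a c => (h a c).2) k m
    refine IdealConucleus.isPrincipal_ofHom (d := d) fun n => ?_
    rw [le_mul_inv_iff_mul_le, ← map_mul, toFreePogroup_le_iff hM, hd]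

end FreePogroup

end Pom

theorem mainTheorem10 (M : Type u) [Monoid M] [PartialOrder M] [MulLeftMono M] [MulRightMono M] :
    -- `FreePogroup M` is the free pogroup over `FPlus M`
    (∀ (H : Type v) [Group H] [PartialOrder H] [MulLeftMono H] [MulRightMono H]
        (f : Pom.FPlus M →*o H),
        ∃! g : Pom.FreePogroup M →*o H, ∀ w, g (Pom.toFreePogroup M w) = f w) ∧
    -- `FPlus M` is an ideal conuclear image of it
    (Pom.IdeallyResiduated M → Pom.IntegrallyClosed M →
      ∃ (σ : Pom.IdealConucleus (Pom.FreePogroup M)) (e : Pom.FPlus M ≃*o σ.image),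
        ∀ w, (e w : Pom.FreePogroup M) = Pom.toFreePogroup M w) ∧
    -- the integrally closed case
    (Pom.IntegrallyClosed M ∧ Pom.IdeallyResiduated M ↔
      ∃ (G : Type u) (_ : Group G) (_ : PartialOrder G) (_ : MulLeftMono G) (_ : MulRightMono G)
        (σ : Pom.IdealConucleus G) (γ : Pom.PoNucleus σ.image), Nonempty (M ≃*o γ.Image)) ∧
    -- the integral case
    (Pom.Integral M ∧ Pom.IdeallyResiduated M ↔
      ∃ (G : Type u) (_ : Group G) (_ : PartialOrder G) (_ : MulLeftMono G) (_ : MulRightMono G)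
        (σ : Pom.IdealConucleus G) (γ : Pom.PoNucleus σ.image),
        σ.Negative ∧ Nonempty (M ≃*o γ.Image)) ∧
    -- the integral residuated case
    (Pom.Integral M ∧ Pom.Residuated M ↔
      ∃ (G : Type u) (_ : Group G) (_ : PartialOrder G) (_ : MulLeftMono G) (_ : MulRightMono G)
        (σ : Pom.IdealConucleus G) (γ : Pom.PoNucleus σ.image),
        σ.Negative ∧ σ.PrincipalOnQuotients ∧ Nonempty (M ≃*o γ.Image)) := by
  refine ⟨fun H _ _ _ _ f => Pom.FreePogroup.existsUnique_lift f,
    fun hR hM => ⟨_, Pom.FreePogroup.exists_iso_image_conucleus hM hR⟩, ⟨?_, ?_⟩, ⟨?_, ?_⟩, ?_, ?_⟩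
  · rintro ⟨hM, hR⟩
    exact ⟨_, _, _, _, _, _, Pom.FreePogroup.exists_nucleus hM hR⟩
  · rintro ⟨G, _, _, _, _, σ, γ, ⟨f⟩⟩
    obtain ⟨r, s, h⟩ := γ.exists_nuclearRetraction f
    exact ⟨h.integrallyClosed σ.integrallyClosed_image,
      h.ideallyResiduated σ.ideallyResiduated_image⟩
  · rintro ⟨hI, hR⟩
    obtain ⟨γ, hγ⟩ := Pom.FreePogroup.exists_nucleus hI.integrallyClosed hR
    exact ⟨_, _, _, _, _, _, γ, Pom.FreePogroup.negative_conucleus _ _ hI, hγ⟩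
  · rintro ⟨G, _, _, _, _, σ, γ, hσ, ⟨f⟩⟩
    obtain ⟨r, s, h⟩ := γ.exists_nuclearRetraction f
    exact ⟨h.integral (σ.integral_image hσ), h.ideallyResiduated σ.ideallyResiduated_image⟩
  · rintro ⟨hI, hR⟩
    obtain ⟨γ, hγ⟩ := Pom.FreePogroup.exists_nucleus hI.integrallyClosed hR.ideallyResiduated
    exact ⟨_, _, _, _, _, _, γ, Pom.FreePogroup.negative_conucleus _ _ hI,
      Pom.FreePogroup.principalOnQuotients_conucleus _ _ hI hR, hγ⟩
  · rintro ⟨G, _, _, _, _, σ, γ, hσ, hp, ⟨f⟩⟩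
    obtain ⟨r, s, h⟩ := γ.exists_nuclearRetraction f
    exact ⟨h.integral (σ.integral_image hσ), h.residuated (σ.residuated_image hp)⟩
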